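/- **Conventions.** Let $\Gamma=(W,E)$ be a finite non-empty simple graph, $A_\Gamma=\langle W\mid [a,b]=1 \text{ for } \{a,b\}\in E\rangle$ its right-angled Artin group, and $\mathbb S_\Gamma$ its Salvetti complex, i.e. the subcomplex of the torus $(S^1)^W$ whose cubes correspond to the cliques of $\Gamma$. Let a group $G$ act by combinatorial isometries on a $\mathrm{CAT}(0)$ cube complex $Z$. Hyperplanes are parallelism classes of edges, and two hyperplanes are transverse if they have dual edges spanning a square; the carrier of a hyperplane is the union of the closed cubes containing an edge dual to it; $\mathrm{Sep}(H\mid K)$ is the set of hyperplanes having the carrier of $H$ in one halfspace and the carrier of $K$ in the other. *Cospecial actions.* A free action of $G$ on $Z$ is *cospecial* if for all $g\in G$ and all hyperplanes $H,K$ of $Z$: (i) if $gH=H$ then $g$ does not exchange the halfspaces of $H$; (ii) $H$ and $gH$ are not transverse; (iii) if the carriers of $H$ and $gH$ intersect, then $H^+\cap gH^+\neq\emptyset$ and $H^-\cap gH^-\neq\emptyset$, where $H^\pm$ are the halfspaces of $H$; (iv) if $H$ and $K$ are transverse and the carriers of $gH$ and $K$ intersect, then $gH$ and $K$ are transverse.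 A *special cube complex* is the quotient $Z/G$ of a cospecial action. *Strong collapses.* A $G$-invariant family $\mathcal H$ of hyperplanes is *strongly collapsible* if $\mathrm{Sep}(H\mid gH)\not\subseteq\mathcal H$ for all $H\in\mathcal H$ and all $g\in G$ with $gH\neq H$. The *collapse* of $\mathcal H$ is the $G$-equivariant restriction quotient of $Z$ onto the $\mathrm{CAT}(0)$ cube complex dual (by Sageev's construction) to the wallspace formed by the vertices of $Z$ and the hyperplanes not in $\mathcal H$; it is a *strong collapse* if $\mathcal H$ is strongly collapsible. *Redundant pairs.* A pair of distinct hyperplanes $\{H_1,H_2\}$ of a locally $\mathrm{CAT}(0)$ cube complex $X$ is *redundant* if there are a locally $\mathrm{CAT}(0)$ cube complex $Y$, a two-sided non-self-intersecting hyperplane $H$ of $Y$, and an isomorphism from $X$ to the subdivision of $Y$ along $H$ (cut at the midpoint of the direction dual to $H$ each cube containing an edge dual to $H$) which maps $H_1,H_2$ to the two hyperplanes into which $H$ is divided. *Cospatial actions.* A free cocompact action of $A_\Gamma$ on a $\mathrm{CAT}(0)$ cube complex $Z$ is *Salvetti-like* if $Z/A_\Gamma$ is combinatorially isomorphic to $\mathbb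 S_\Gamma$. It is *cospatial* if $Z/A_\Gamma$ has no redundant pair of hyperplanes and, for every hyperplane $H$ of $Z$, there is a strong collapse of $Z$ that does not collapse $H$ and whose range is Salvetti-like. A *spatial cube complex* is the quotient of a cospatial action of $A_\Gamma$, for some finite non-empty simple graph $\Gamma$. **Lemma.** Every cospatial action of a right-angled Artin group $A_\Gamma$ is cospecial. In particular, every spatial cube complex is special. The converse fails: let $\mathbb Z^2=A_\Gamma$, with $\Gamma$ a single edge, act on $\mathbb R^2$ with its standard cubical subdivision, the two standard generators acting as the translations by $(1,1)$ and $(-1,1)$. This action is free, cocompact and cospecial, but not cospatial; its quotient is a special cube complex which is not spatial. -/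

import Mathlib

open scoped Pointwise

universe u v

namespace CubeCx

/-! ## Faces of cubes and cube complexes -/

/-- A parametrized `m`-face of the cube `[0,1]^n`: the affine isometric map `[0,1]^m → [0,1]^n`
sending the origin to the vertex `base` and the `i`-th axis to the axis `dir i`. Every isometry of
`[0,1]^m` onto an `m`-dimensional face of `[0,1]^n` is of this form, in a unique way. For `m = n`
these are the symmetries of the cube. -/
@[ext]
structure FaceMap (m n : ℕ) where
  base : Fin n → Bool
  dir : Fin m ↪ Fin n

namespace FaceMap

/-- The action of a face map on vertices of cubes. -/
noncomputable def app {m n : ℕ} (f : FaceMap m n) (x : Fin m → Bool) : Fin n → Bool :=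
  fun j => xor (f.base j) (Function.extend f.dir x (fun _ => false) j)

/-- The action of a face map on points (with rational coordinates) of cubes. -/
noncomputable def affine {m n : ℕ} (f : FaceMap m n) (p : Fin m → ℚ) : Fin n → ℚ :=
  fun j =>
    if f.base j then 1 - Function.extend f.dir p (fun _ => 0) j
    else Function.extend f.dir p (fun _ => 0) j

/-- The identity of the cube. -/
def idm (n : ℕ) : FaceMap n n := ⟨fun _ => false, Function.Embedding.refl _⟩

/-- Composition of face maps (`g` after `f`). -/
noncomputable def comp {k m n : ℕ} (g : FaceMap m n) (f : FaceMap k m) : FaceMap k n :=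
  ⟨g.app f.base, f.dir.trans g.dir⟩

/-- The vertex `x` of a cube. -/
def vertex {n : ℕ} (x : Fin n → Bool) : FaceMap 0 n := ⟨x, ⟨Fin.elim0, fun a => a.elim0⟩⟩

/-- The edge of a cube issued from the vertex `x` in the direction `i`. -/
def edge {n : ℕ} (x : Fin n → Bool) (i : Fin n) : FaceMap 1 n :=
  ⟨x, ⟨fun _ => i, fun _ _ _ => Subsingleton.elim _ _⟩⟩

/-- The reversal `t ↦ 1 - t` of the unit interval. -/
def rev : FaceMap 1 1 := edge (fun _ => true) 0

theorem app_dir {m n : ℕ} (f : FaceMap m n) (x : Fin m → Bool) (i : Fin m) :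
    f.app x (f.dir i) = xor (f.base (f.dir i)) (x i) := by
  simp [app, f.dir.injective.extend_apply]

theorem app_of_not {m n : ℕ} (f : FaceMap m n) (x : Fin m → Bool) (j : Fin n)
    (h : ¬ ∃ i, f.dir i = j) : f.app x j = f.base j := by
  simp [app, Function.extend_apply' _ _ _ h]

theorem app_idm {n : ℕ} (x : Fin n → Bool) : (idm n).app x = x := by
  funext j
  have := app_dir (idm n) x j
  simpa [idm] using this

theorem app_comp {k m n : ℕ} (g : FaceMap m n) (f : FaceMap k m) (x : Fin k → Bool) :
    (g.comp f).app x = g.app (f.app x) := by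
  funext j
  by_cases hj : ∃ i, g.dir i = j
  · obtain ⟨i, rfl⟩ := hj
    rw [app_dir g]
    by_cases hi : ∃ l, f.dir l = i
    · obtain ⟨l, rfl⟩ := hi
      have := app_dir (g.comp f) x l
      simp only [comp, Function.Embedding.trans_apply] at this ⊢
      rw [this, app_dir g, app_dir f, Bool.xor_assoc]
    · rw [app_of_not f x i hi, app_of_not]
      · simp only [comp]
        rw [app_dir g]
      · rintro ⟨l, hl⟩
        exact hi ⟨l, g.dir.injective hl⟩
  · rw [app_of_not g _ j hj, app_of_not]
    · simp only [comp]
      rw [app_of_not g _ j hj]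
    · rintro ⟨l, hl⟩
      exact hj ⟨f.dir l, hl⟩

theorem hammingDist_app {m n : ℕ} (f : FaceMap m n) (x y : Fin m → Bool) :
    hammingDist (f.app x) (f.app y) = hammingDist x y := by
  unfold hammingDist
  rw [← Finset.card_map f.dir]
  congr 1
  ext j
  simp only [Finset.mem_filter, Finset.mem_univ, true_and, Finset.mem_map]
  constructor
  · intro h
    by_cases hj : ∃ i, f.dir i = j
    · obtain ⟨i, rfl⟩ := hj
      refine ⟨i, ?_, rfl⟩
      rintro hxy
      exact h (by rw [app_dir, app_dir, hxy])
    · exact absurd (by rw [app_of_not f x j hj, app_of_not f y j hj]) h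
  · rintro ⟨i, h, rfl⟩
    rw [app_dir, app_dir]
    intro h'
    exact h (by simpa using h')

theorem edge_zero_eq : edge (fun _ : Fin 1 => false) 0 = idm 1 := by
  ext i
  · rfl
  · simp

end FaceMap

/-- A (possibly orbifold) cube complex, given by its *parametrized cubes*: `Cell n` is the set of
characteristic maps `[0,1]^n → X` of `n`-dimensional cubes (so that each `n`-cube of `X` occurs once
for each symmetry of `[0,1]^n`), and `face f c` is the restriction of the characteristic map `c`
to a parametrized face `f`. Cubes may be glued to themselves and to each other along faces in an
arbitrary way. -/
structure CubicalSet where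
  Cell : ℕ → Type u
  face : ∀ {m n : ℕ}, FaceMap m n → Cell n → Cell m
  face_idm : ∀ {n : ℕ} (c : Cell n), face (FaceMap.idm n) c = c
  face_comp : ∀ {k m n : ℕ} (g : FaceMap m n) (f : FaceMap k m) (c : Cell n),
    face (g.comp f) c = face f (face g c)

namespace CubicalSet

/-- Combinatorial isomorphisms. -/
structure Iso (X : CubicalSet.{u}) (Y : CubicalSet.{v}) where
  equiv : ∀ n, X.Cell n ≃ Y.Cell n
  map_face : ∀ {m n : ℕ} (f : FaceMap m n) (c : X.Cell n),
    equiv m (X.face f c) = Y.face f (equiv n c)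

/-- `X` is a genuine cube complex: the interior of each cube embeds, i.e. no cube is identified
with itself through a nontrivial symmetry. -/
def IsCubeComplex (X : CubicalSet.{u}) : Prop :=
  ∀ (n : ℕ) (c : X.Cell n) (f : FaceMap n n), X.face f c = c → f = FaceMap.idm n

/-- A cube complex has finitely many cells if and only if it is compact. -/
def IsCompact (X : CubicalSet.{u}) : Prop := Finite (Σ n, X.Cell n)

/-- The initial vertex of a parametrized cube. -/
def origin (X : CubicalSet.{u}) {n : ℕ} (c : X.Cell n) : X.Cell 0 :=
  X.face (FaceMap.vertex fun _ => false) c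

/-- The edge of a parametrized cube issued from its initial vertex in the direction `i`. -/
def axis (X : CubicalSet.{u}) {n : ℕ} (c : X.Cell n) (i : Fin n) : X.Cell 1 :=
  X.face (FaceMap.edge (fun _ => false) i) c

/-- The same edge with the opposite parametrization. -/
def reverse (X : CubicalSet.{u}) (e : X.Cell 1) : X.Cell 1 := X.face FaceMap.rev e

/-- The oriented edges `e`, `f` are the corners of a square at a vertex. -/
def SpanSquare (X : CubicalSet.{u}) (e f : X.Cell 1) : Prop :=
  ∃ s : X.Cell 2, X.axis s 0 = e ∧ X.axis s 1 = f

/-- Gromov's link condition: the link of each vertex is a flag simplicial complex. The vertices of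
the link of `v` are the oriented edges issued from `v`, and its simplices are the corners at `v` of
cubes of `X`. -/
structure LinkCondition (X : CubicalSet.{u}) : Prop where
  simplicial : ∀ s : X.Cell 2, X.axis s 0 ≠ X.axis s 1
  flag : ∀ (v : X.Cell 0) (n : ℕ) (e : Fin n → X.Cell 1), (∀ i, X.origin (e i) = v) →
    (∀ i j, i ≠ j → X.SpanSquare (e i) (e j)) →
    ∃! c : X.Cell n, X.origin c = v ∧ ∀ i, X.axis c i = e i

/-- Locally CAT(0) cube complexes. -/
def IsLocallyCAT0 (X : CubicalSet.{u}) : Prop := X.IsCubeComplex ∧ X.LinkCondition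

/-- `e` and `f` are opposite edges of a square, with the same orientation. -/
def Opposite (X : CubicalSet.{u}) (e f : X.Cell 1) : Prop :=
  ∃ s : X.Cell 2, X.face (FaceMap.edge ![false, false] 0) s = e ∧
    X.face (FaceMap.edge ![false, true] 0) s = f

/-- Parallelism of oriented edges. -/
def OrientedParallel (X : CubicalSet.{u}) : X.Cell 1 → X.Cell 1 → Prop :=
  Relation.EqvGen X.Opposite

/-- The hyperplane dual to the edge `e`: all edges parallel to `e`, with both parametrizations. -/
def hyperplane (X : CubicalSet.{u}) (e : X.Cell 1) : Set (X.Cell 1) :=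
  {f | X.OrientedParallel e f ∨ X.OrientedParallel (X.reverse e) f}

/-- The hyperplane dual to `e` is two-sided. -/
def TwoSided (X : CubicalSet.{u}) (e : X.Cell 1) : Prop :=
  ¬ X.OrientedParallel e (X.reverse e)

/-- The hyperplane dual to `e` does not self-intersect: no two adjacent edges of a square are dual
to it. -/
def NonSelfIntersecting (X : CubicalSet.{u}) (e : X.Cell 1) : Prop :=
  ∀ s : X.Cell 2, ¬ (X.axis s 0 ∈ X.hyperplane e ∧ X.axis s 1 ∈ X.hyperplane e)

/-! ### Subdivision along a hyperplane -/

open Classical in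
/-- Subdivide the cube `[0,1]^m` along the directions in `D`, by cutting `[0,1]` at `1/2` in each of
these directions. `φ` parametrizes an `n`-cube of this subdivision: it is an isometric embedding
of the vertices of the `n`-cube into the vertices of the subdivision, where distances are
measured in the `1`-skeleton of the subdivision (its edges in directions of `D` have length `1/2` in
`[0,1]^m`). -/
def IsSubdividedCube {m n : ℕ} (D : Set (Fin m)) (φ : (Fin n → Bool) → (Fin m → ℚ)) : Prop :=
  (∀ x i, φ x i = 0 ∨ φ x i = 1 ∨ (i ∈ D ∧ φ x i = 1 / 2)) ∧
  ∀ x y, ∑ i, (if i ∈ D then 2 else 1) * |φ x i - φ y i| = (hammingDist x y : ℚ)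

/-- A parametrized `n`-cube of the subdivision, along the hyperplane dual to `e`, of some cube
of `X`. -/
structure SubCell (X : CubicalSet.{u}) (e : X.Cell 1) (n : ℕ) where
  dim : ℕ
  cube : X.Cell dim
  map : (Fin n → Bool) → (Fin dim → ℚ)
  isCube : IsSubdividedCube {i | X.axis cube i ∈ X.hyperplane e} map

/-- Cubes of the subdivision of a face of a cube `c` are cubes of the subdivision of `c`. -/
def SubRel (X : CubicalSet.{u}) (e : X.Cell 1) (n : ℕ) (s t : X.SubCell e n) : Prop :=
  ∃ f : FaceMap s.dim t.dim, s.cube = X.face f t.cube ∧ ∀ x, t.map x = f.affine (s.map x)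

/-- Restriction of a cube of the subdivision to a face. -/
noncomputable def SubCell.face {X : CubicalSet.{u}} {e : X.Cell 1} {k n : ℕ} (f : FaceMap k n)
    (s : X.SubCell e n) : X.SubCell e k where
  dim := s.dim
  cube := s.cube
  map := fun x => s.map (f.app x)
  isCube := ⟨fun x i => s.isCube.1 (f.app x) i, fun x y => by
    rw [s.isCube.2, FaceMap.hammingDist_app]⟩

/-- The subdivision of `X` along the hyperplane dual to `e`: glue the subdivisions of the cubes
of `X`. -/
noncomputable def subdivision (X : CubicalSet.{u}) (e : X.Cell 1) : CubicalSet.{u} where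
  Cell n := Quot (X.SubRel e n)
  face f := Quot.map (SubCell.face f) (by
    rintro s t ⟨g, hc, hm⟩
    exact ⟨g, hc, fun x => hm _⟩)
  face_idm := by
    rintro n ⟨s⟩
    simp only [Quot.map, SubCell.face, FaceMap.app_idm]
  face_comp := by
    rintro k m n g f ⟨s⟩
    simp only [Quot.map, SubCell.face, FaceMap.app_comp]

theorem mem_hyperplane_self (X : CubicalSet.{u}) (e : X.Cell 1) (i : Fin 1) :
    X.axis e i ∈ X.hyperplane e := by
  have hi : i = 0 := Subsingleton.elim _ _
  subst hi
  unfold axis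
  rw [FaceMap.edge_zero_eq, X.face_idm]
  exact Or.inl (Relation.EqvGen.refl _)

/-- The first half `[0,1/2]` of the edge `e` in the subdivision along its dual hyperplane. -/
def lowerHalf (X : CubicalSet.{u}) (e : X.Cell 1) : (X.subdivision e).Cell 1 :=
  Quot.mk _
    { dim := 1
      cube := e
      map := fun x _ => if x 0 then 1 / 2 else 0
      isCube := by
        refine ⟨fun x i => ?_, fun x y => ?_⟩
        · by_cases h : x 0 <;> simp [h, mem_hyperplane_self]
        · simp only [Set.mem_ofPred_eq, mem_hyperplane_self, hammingDist]
          rcases hx : x 0 <;> rcases hy : y 0 <;> simp [hx, hy, Finset.filter_singleton] }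

/-- The second half `[1/2,1]` of the edge `e` in the subdivision along its dual hyperplane. -/
def upperHalf (X : CubicalSet.{u}) (e : X.Cell 1) : (X.subdivision e).Cell 1 :=
  Quot.mk _
    { dim := 1
      cube := e
      map := fun x _ => if x 0 then 1 else 1 / 2
      isCube := by
        refine ⟨fun x i => ?_, fun x y => ?_⟩
        · by_cases h : x 0 <;> simp [h, mem_hyperplane_self]
        · simp only [Set.mem_ofPred_eq, mem_hyperplane_self, hammingDist]
          rcases hx : x 0 <;> rcases hy : y 0 <;>
            norm_num [hx, hy, Finset.filter_singleton, abs_of_pos, abs_of_neg] }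

/-- The pair of hyperplanes `{H₁, H₂}` of `X` is redundant: they are distinct, and `X` is isomorphic
to the subdivision of a locally CAT(0) cube complex `Y` along a two-sided, non-self-intersecting
hyperplane (the one dual to the edge `e`), in such a way that `H₁`, `H₂` correspond to the two
hyperplanes of the subdivision dual to the halves of `e`. -/
def IsRedundantPair (X : CubicalSet.{u}) (H₁ H₂ : Set (X.Cell 1)) : Prop :=
  H₁ ≠ H₂ ∧ ∃ (Y : CubicalSet.{u}) (e : Y.Cell 1),
    Y.IsLocallyCAT0 ∧ Y.TwoSided e ∧ Y.NonSelfIntersecting e ∧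
    ∃ Φ : Iso X (Y.subdivision e),
      Φ.equiv 1 '' H₁ = (Y.subdivision e).hyperplane (Y.lowerHalf e) ∧
      Φ.equiv 1 '' H₂ = (Y.subdivision e).hyperplane (Y.upperHalf e)

end CubicalSet

/-! ## CAT(0) cube complexes

A CAT(0) cube complex is determined by its `1`-skeleton, which is a median graph; conversely, any
median graph is the `1`-skeleton of a CAT(0) cube complex, with a cube glued on each subgraph
isomorphic to the `1`-skeleton of a cube. We identify CAT(0) cube complexes with median graphs. -/

section CAT0

variable {V : Type u}

/-- Median graphs. -/
def IsMedian (Z : SimpleGraph V) : Prop :=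
  Z.Connected ∧ ∀ x y z : V, ∃! m : V,
    Z.dist x y = Z.dist x m + Z.dist m y ∧
    Z.dist y z = Z.dist y m + Z.dist m z ∧
    Z.dist x z = Z.dist x m + Z.dist m z

/-- The parametrized `n`-cubes of `Z`. -/
def IsCube (Z : SimpleGraph V) {n : ℕ} (c : (Fin n → Bool) → V) : Prop :=
  ∀ x y, Z.dist (c x) (c y) = hammingDist x y

/-- The oriented edges `p` and `q` are opposite edges of a square, with the same orientation. -/
def Opposite (Z : SimpleGraph V) (p q : V × V) : Prop :=
  Z.Adj p.1 p.2 ∧ Z.Adj q.1 q.2 ∧ Z.Adj p.1 q.1 ∧ Z.Adj p.2 q.2 ∧ p.1 ≠ q.2 ∧ p.2 ≠ q.1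

/-- Parallelism of edges, regardless of orientation. -/
def Parallel (Z : SimpleGraph V) : V × V → V × V → Prop :=
  Relation.EqvGen fun p q => Opposite Z p q ∨ q = p.swap

/-- Hyperplanes are parallelism classes of edges; an edge is seen here as a pair of mutually reverse
oriented edges. -/
def IsHyperplane (Z : SimpleGraph V) (H : Set (V × V)) : Prop :=
  ∃ p : V × V, Z.Adj p.1 p.2 ∧ H = {q | Parallel Z p q}

/-- `x` and `y` are joined by an edge path with no edge dual to `H`. -/
def SameSide (Z : SimpleGraph V) (H : Set (V × V)) : V → V → Prop :=
  Relation.ReflTransGen fun x y => Z.Adj x y ∧ (x, y) ∉ H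

/-- Halfspaces of `H` (as sets of vertices): connected components of the complement of the open
carrier of `H`. -/
def IsHalfspace (Z : SimpleGraph V) (H : Set (V × V)) (S : Set V) : Prop :=
  ∃ x, S = {y | SameSide Z H x y}

/-- The vertices of the carrier of `H`: each vertex of a cube which contains an edge dual to `H` is
itself an endpoint of an edge dual to `H`. -/
def carrier (H : Set (V × V)) : Set V := {x | ∃ y, (x, y) ∈ H}

/-- Transverse hyperplanes have dual edges that span a square. -/
def Transverse (Z : SimpleGraph V) (H K : Set (V × V)) : Prop :=
  ∃ a b c d : V, Opposite Z (a, b) (c, d) ∧ (a, b) ∈ H ∧ (a, c) ∈ K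

/-- The separator of two sets of vertices. -/
def separator (Z : SimpleGraph V) (A B : Set V) : Set (Set (V × V)) :=
  {K | IsHyperplane Z K ∧ ∃ S T, IsHalfspace Z K S ∧ IsHalfspace Z K T ∧ S ≠ T ∧ A ⊆ S ∧ B ⊆ T}

end CAT0

/-! ## Group actions -/

section Action

variable (G : Type v) [Group G] {V : Type u} [MulAction G V]

/-- `G` acts on `Z` by combinatorial isometries. -/
def IsIsometric (Z : SimpleGraph V) : Prop := ∀ (g : G) (x y : V), Z.Adj (g • x) (g • y) ↔ Z.Adj x y

/-- `G` acts freely on the cube complex `Z`: a nontrivial element fixes no point, equivalently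
stabilizes no cube. -/
def IsFree (Z : SimpleGraph V) : Prop :=
  ∀ (g : G) (n : ℕ) (c : (Fin n → Bool) → V), IsCube Z c → g • Set.range c = Set.range c → g = 1

/-- The quotient cube complex `Z/G`: its parametrized cubes are the `G`-orbits of parametrized cubes
of `Z`. -/
noncomputable def quotient (Z : SimpleGraph V) : CubicalSet.{u} where
  Cell n := Quot fun c c' : {c : (Fin n → Bool) → V // IsCube Z c} =>
    ∃ g : G, ∀ x, g • c.1 x = c'.1 x
  face f := Quot.map
    (fun c => ⟨fun x => c.1 (f.app x), fun x y => by rw [c.2, FaceMap.hammingDist_app]⟩)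
    (by
      rintro c c' ⟨g, h⟩
      exact ⟨g, fun x => h _⟩)
  face_idm := by
    rintro n ⟨c⟩
    simp only [Quot.map, FaceMap.app_idm]
  face_comp := by
    rintro k m n g f ⟨c⟩
    simp only [Quot.map, FaceMap.app_comp]

/-- A free action by combinatorial isometries on a CAT(0) cube complex. -/
structure IsFreeCAT0Action (Z : SimpleGraph V) : Prop where
  median : IsMedian Z
  isometric : IsIsometric G Z
  free : IsFree G Z

/-- A free cocompact action by combinatorial isometries on a CAT(0) cube complex. -/
structure IsGeometric (Z : SimpleGraph V) : Prop extends IsFreeCAT0Action G Z where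
  cocompact : (quotient G Z).IsCompact

/-- Cospecial actions. -/
structure IsCospecial (Z : SimpleGraph V) : Prop extends IsFreeCAT0Action G Z where
  two_sided : ∀ (g : G) (H : Set (V × V)), IsHyperplane Z H → g • H = H →
    ∀ S, IsHalfspace Z H S → g • S = S
  no_self_intersection : ∀ (g : G) (H : Set (V × V)), IsHyperplane Z H → ¬ Transverse Z H (g • H)
  no_direct_self_osculation : ∀ (g : G) (H : Set (V × V)), IsHyperplane Z H →
    (carrier H ∩ carrier (g • H)).Nonempty → ∀ S, IsHalfspace Z H S → (S ∩ g • S).Nonempty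
  no_inter_osculation : ∀ (g : G) (H K : Set (V × V)), IsHyperplane Z H → IsHyperplane Z K →
    Transverse Z H K → (carrier (g • H) ∩ carrier K).Nonempty → Transverse Z (g • H) K

/-- `𝓗` is a `G`-invariant family of hyperplanes of `Z`. -/
structure IsInvariantFamily (Z : SimpleGraph V) (𝓗 : Set (Set (V × V))) : Prop where
  hyperplane : ∀ H ∈ 𝓗, IsHyperplane Z H
  invariant : ∀ (g : G), ∀ H ∈ 𝓗, g • H ∈ 𝓗

/-- Strongly collapsible families of hyperplanes. -/
structure IsStronglyCollapsible (Z : SimpleGraph V) (𝓗 : Set (Set (V × V))) : Prop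
    extends IsInvariantFamily G Z 𝓗 where
  strong : ∀ H ∈ 𝓗, ∀ g : G, g • H ≠ H → ¬ separator Z (carrier H) (carrier (g • H)) ⊆ 𝓗

end Action

/-! ## Sageev's construction and collapses -/

section Sageev

variable {E : Type u}

/-- The vertices of the cube complex dual to a wallspace structure on `E`. The walls are the
partitions `{h, hᶜ}` with `h ∈ 𝓢`, and a vertex is a choice of one part in each partition. -/
@[ext]
structure DualVertex (𝓢 : Set (Set E)) where
  parts : Set (Set E)
  subset : parts ⊆ 𝓢
  choice : ∀ h ∈ 𝓢, Xor (h ∈ parts) (hᶜ ∈ parts)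
  inter : ∀ h ∈ parts, ∀ k ∈ parts, (h ∩ k).Nonempty
  finite : ∀ x : E, {h ∈ parts | x ∉ h}.Finite

/-- The `1`-skeleton of the cube complex dual to a wallspace: two vertices are adjacent when they
have the same chosen parts for all partitions except one. -/
def dualGraph (𝓢 : Set (Set E)) : SimpleGraph (DualVertex 𝓢) where
  Adj σ τ := ∃ h, σ.parts \ τ.parts = {h} ∧ τ.parts \ σ.parts = {hᶜ}
  symm := ⟨by
    rintro σ τ ⟨h, h₁, h₂⟩
    exact ⟨hᶜ, h₂, by rw [h₁, compl_compl]⟩⟩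
  loopless := ⟨by
    rintro σ ⟨h, h₁, -⟩
    rw [Set.sdiff_self] at h₁
    exact Set.singleton_ne_empty h h₁.symm⟩

/-- The action induced on the cube complex dual to a wallspace by an action preserving the walls. -/
abbrev dualAction {G : Type v} [Group G] [MulAction G E] {𝓢 : Set (Set E)}
    (h𝓢 : ∀ (g : G), ∀ h ∈ 𝓢, g • h ∈ 𝓢) : MulAction G (DualVertex 𝓢) where
  smul g σ :=
    { parts := g • σ.parts
      subset := by
        rintro _ ⟨h, hh, rfl⟩
        exact h𝓢 g h (σ.subset hh)
      choice := by
        intro h hh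
        rw [Set.mem_smul_set_iff_inv_smul_mem, Set.mem_smul_set_iff_inv_smul_mem,
          Set.smul_set_compl]
        exact σ.choice _ (h𝓢 _ _ hh)
      inter := by
        rintro _ ⟨h, hh, rfl⟩ _ ⟨k, hk, rfl⟩
        obtain ⟨x, hx, hx'⟩ := σ.inter h hh k hk
        exact ⟨g • x, Set.smul_mem_smul_set hx, Set.smul_mem_smul_set hx'⟩
      finite := by
        intro x
        refine ((σ.finite (g⁻¹ • x)).image fun h => g • h).subset ?_
        rintro _ ⟨⟨h, hh, rfl⟩, hx⟩
        exact ⟨h, ⟨hh, fun h' => hx (Set.mem_smul_set_iff_inv_smul_mem.2 h')⟩, rfl⟩ }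
  one_smul σ := DualVertex.ext (one_smul G σ.parts)
  mul_smul g k σ := DualVertex.ext (mul_smul g k σ.parts)

variable {V : Type u}

/-- The halfspaces of the hyperplanes of `Z` that do not belong to `𝓗`. -/
def remainingHalfspaces (Z : SimpleGraph V) (𝓗 : Set (Set (V × V))) : Set (Set V) :=
  {S | ∃ H, IsHyperplane Z H ∧ H ∉ 𝓗 ∧ IsHalfspace Z H S}

/-- The range of the collapse of `𝓗`: the restriction quotient of `Z` associated with the hyperplanes
that do not belong to `𝓗`. -/
abbrev collapse (Z : SimpleGraph V) (𝓗 : Set (Set (V × V))) :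
    SimpleGraph (DualVertex (remainingHalfspaces Z 𝓗)) :=
  dualGraph (remainingHalfspaces Z 𝓗)

section Equivariance

variable {G : Type v} [Group G] [MulAction G V] {Z : SimpleGraph V}

theorem Parallel.smul (hZ : IsIsometric G Z) (g : G) {p q : V × V} (h : Parallel Z p q) :
    Parallel Z (g • p) (g • q) := by
  induction h with
  | rel p q h =>
    refine Relation.EqvGen.rel _ _ ?_
    rcases h with ⟨h1, h2, h3, h4, h5, h6⟩ | rfl
    · exact Or.inl ⟨(hZ g _ _).2 h1, (hZ g _ _).2 h2, (hZ g _ _).2 h3, (hZ g _ _).2 h4,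
        fun h => h5 (MulAction.injective g h), fun h => h6 (MulAction.injective g h)⟩
    · exact Or.inr rfl
  | refl p => exact Relation.EqvGen.refl _
  | symm p q _ ih => exact Relation.EqvGen.symm _ _ ih
  | trans p q r _ _ ih₁ ih₂ => exact Relation.EqvGen.trans _ _ _ ih₁ ih₂

theorem IsHyperplane.smul (hZ : IsIsometric G Z) (g : G) {H : Set (V × V)}
    (h : IsHyperplane Z H) : IsHyperplane Z (g • H) := by
  obtain ⟨p, hp, rfl⟩ := h
  refine ⟨g • p, (hZ g _ _).2 hp, ?_⟩
  ext q
  rw [Set.mem_smul_set_iff_inv_smul_mem]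
  constructor
  · intro h
    have := Parallel.smul hZ g h
    rwa [smul_inv_smul] at this
  · intro h
    have := Parallel.smul hZ g⁻¹ h
    rwa [inv_smul_smul] at this

theorem SameSide.smul (hZ : IsIsometric G Z) (g : G) {H : Set (V × V)} {x y : V}
    (h : SameSide Z H x y) : SameSide Z (g • H) (g • x) (g • y) := by
  unfold SameSide at h
  induction h with
  | refl => exact Relation.ReflTransGen.refl
  | @tail a b _ hab ih =>
    refine Relation.ReflTransGen.tail ih ⟨(hZ g _ _).2 hab.1, fun h' => hab.2 ?_⟩
    have : g • (a, b) ∈ g • H := h'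
    exact Set.smul_mem_smul_set_iff.1 this

theorem IsHalfspace.smul (hZ : IsIsometric G Z) (g : G) {H : Set (V × V)} {S : Set V}
    (h : IsHalfspace Z H S) : IsHalfspace Z (g • H) (g • S) := by
  obtain ⟨x, rfl⟩ := h
  refine ⟨g • x, ?_⟩
  ext y
  rw [Set.mem_smul_set_iff_inv_smul_mem]
  constructor
  · intro h
    have := SameSide.smul hZ g h
    rwa [smul_inv_smul] at this
  · intro h
    have := SameSide.smul hZ g⁻¹ h
    rwa [inv_smul_smul, inv_smul_smul] at this

theorem remainingHalfspaces_smul (hZ : IsIsometric G Z) {𝓗 : Set (Set (V × V))}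
    (h𝓗 : IsInvariantFamily G Z 𝓗) (g : G) :
    ∀ S ∈ remainingHalfspaces Z 𝓗, g • S ∈ remainingHalfspaces Z 𝓗 := by
  rintro S ⟨H, hH, hn, hS⟩
  refine ⟨g • H, hH.smul hZ g, fun h => hn ?_, hS.smul hZ g⟩
  have := h𝓗.invariant g⁻¹ _ h
  rwa [inv_smul_smul] at this

/-- The action of `G` on the range of the collapse of an invariant family of hyperplanes. -/
abbrev collapseAction (hZ : IsIsometric G Z) {𝓗 : Set (Set (V × V))}
    (h𝓗 : IsInvariantFamily G Z 𝓗) : MulAction G (DualVertex (remainingHalfspaces Z 𝓗)) :=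
  dualAction (remainingHalfspaces_smul hZ h𝓗)

end Equivariance

end Sageev

/-! ## Right-angled Artin groups, Salvetti complexes, cospatial actions -/

section RAAG

variable {W : Type v} (Γ : SimpleGraph W)

/-- The right-angled Artin group of a graph. -/
abbrev RAAG : Type v :=
  PresentedGroup {r : FreeGroup W | ∃ a b : W, Γ.Adj a b ∧
    r = FreeGroup.of a * FreeGroup.of b * (FreeGroup.of a)⁻¹ * (FreeGroup.of b)⁻¹}

/-- The Salvetti complex, the subcomplex of the torus `(S¹)^W` whose cubes correspond to cliques
of `Γ`. A parametrized `n`-cube is given by an ordered clique of size `n`, and an orientation of each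
of the corresponding directions of the torus. -/
def salvetti : CubicalSet.{v} where
  Cell n := {c : Fin n → W × Bool // ∀ i j, i ≠ j → Γ.Adj (c i).1 (c j).1}
  face f c := ⟨fun i => ((c.1 (f.dir i)).1, xor (c.1 (f.dir i)).2 (f.base (f.dir i))),
    fun i j hij => c.2 _ _ fun h => hij (f.dir.injective h)⟩
  face_idm := by
    rintro n ⟨c, hc⟩
    simp [FaceMap.idm]
  face_comp := by
    rintro k m n g f ⟨c, hc⟩
    simp only [FaceMap.comp, Function.Embedding.trans_apply, FaceMap.app_dir, Bool.xor_assoc]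

variable {V : Type u}

/-- Salvetti-like actions of a right-angled Artin group. -/
structure IsSalvettiLike (Z : SimpleGraph V) [MulAction (RAAG Γ) V] : Prop
    extends IsGeometric (RAAG Γ) Z where
  iso : Nonempty (CubicalSet.Iso (quotient (RAAG Γ) Z) (salvetti Γ))

/-- Cospatial actions of a right-angled Artin group. -/
structure IsCospatial (Z : SimpleGraph V) [MulAction (RAAG Γ) V] : Prop
    extends IsGeometric (RAAG Γ) Z where
  no_redundant_pair : ¬ ∃ H₁ H₂, (quotient (RAAG Γ) Z).IsRedundantPair H₁ H₂
  exists_collapse : ∀ H, IsHyperplane Z H →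
    ∃ (𝓗 : Set (Set (V × V))) (h𝓗 : IsStronglyCollapsible (RAAG Γ) Z 𝓗), H ∉ 𝓗 ∧
      letI := collapseAction isometric h𝓗.toIsInvariantFamily
      IsSalvettiLike Γ (collapse Z 𝓗)

end RAAG

/-- Spatial cube complexes: quotients of cospatial actions of right-angled Artin groups (of finite
non-empty graphs). -/
def IsSpatial (X : CubicalSet.{u}) : Prop :=
  ∃ (W : Type u) (_ : Finite W) (_ : Nonempty W) (Γ : SimpleGraph W)
    (V : Type u) (Z : SimpleGraph V) (_ : MulAction (RAAG Γ) V),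
    IsCospatial Γ Z ∧ Nonempty (CubicalSet.Iso X (quotient (RAAG Γ) Z))

/-- Special cube complexes: quotients of cospecial actions. -/
def IsSpecial (X : CubicalSet.{u}) : Prop :=
  ∃ (G : Type u) (_ : Group G) (V : Type u) (Z : SimpleGraph V) (_ : MulAction G V),
    IsCospecial G Z ∧ Nonempty (CubicalSet.Iso X (quotient G Z))

/-- The `1`-skeleton of the standard cubical subdivision of the plane. -/
noncomputable abbrev squareGrid : SimpleGraph (ℤ × ℤ) := (SimpleGraph.hasse ℤ).boxProd (SimpleGraph.hasse ℤ)

/-- The graph with two adjacent vertices; its right-angled Artin group is `ℤ²`. -/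
abbrev edgeGraph : SimpleGraph (Fin 2) := ⊤

end CubeCx

/-!
Fix a strong collapse `π` of `Z` keeping the hyperplane `H`, with Salvetti-like range. The oriented
edges of the range are labelled by oriented generators of `A_Γ`; the label is invariant under the
group and under parallelism, at most one edge with a given label issues from a given vertex, and
edges at a vertex span a square exactly when their labels are adjacent in `Γ`. Pulling labels back
by `π` gives (i)–(iii) for `H`, and (iv) when `K` is not collapsed. If `K` is collapsed, strong
collapsibility implies that translates of `K` whose carriers contain vertices with the same image
are equal; this allows one to move `H` to `gH` by an element stabilizing `K`.

The quotient of the grid by the diagonal action has two vertices, and each of its hyperplanes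
indirectly self-osculates: each hyperplane of the grid has a distinct translate with intersecting
carrier. Such a hyperplane belongs to no strongly collapsible family, so that the only strong
collapse is the identity, whereas a Salvetti complex has a single vertex.
-/

namespace CubeCx

/-! ## Median graphs -/

section Median

variable {V : Type u} {Z : SimpleGraph V} {a b c d x y : V} {p q : V × V}

theorem exists_adj_dist_eq (hZ : Z.Connected) {n : ℕ} (h : Z.dist x y = n + 1) :
    ∃ z, Z.Adj x z ∧ Z.dist z y = n := by
  obtain ⟨w, hw⟩ := hZ.exists_walk_length_eq_dist x y
  cases w with
  | nil => simp at h
  | @cons _ z _ hxz w =>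
    have hle := SimpleGraph.dist_le w
    have htri := hZ.dist_triangle (u := x) (v := z) (w := y)
    rw [SimpleGraph.dist_eq_one_iff_adj.2 hxz] at htri
    rw [SimpleGraph.Walk.length_cons] at hw
    exact ⟨z, hxz, by omega⟩

theorem exists_crossing (hZ : Z.Connected) {S : Set V} (hx : x ∈ S) (hy : y ∉ S) :
    ∃ c d, Z.Adj c d ∧ c ∈ S ∧ d ∉ S ∧ Z.dist x y = Z.dist x c + 1 + Z.dist d y := by
  obtain ⟨n, hn⟩ : ∃ n, Z.dist x y = n := ⟨_, rfl⟩
  induction n generalizing x with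
  | zero =>
    obtain rfl := hZ.dist_eq_zero_iff.1 hn
    exact absurd hx hy
  | succ n ih =>
    obtain ⟨z, hxz, hz⟩ := exists_adj_dist_eq hZ hn
    by_cases hzS : z ∈ S
    · obtain ⟨c, d, hcd, hc, hd, hdist⟩ := ih hzS hz
      have hxc := hZ.dist_triangle (u := x) (v := z) (w := c)
      have hxy := hZ.dist_triangle (u := x) (v := c) (w := y)
      have hcy := hZ.dist_triangle (u := c) (v := d) (w := y)
      rw [SimpleGraph.dist_eq_one_iff_adj.2 hxz] at hxc
      rw [SimpleGraph.dist_eq_one_iff_adj.2 hcd] at hcy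
      exact ⟨c, d, hcd, hc, hd, by omega⟩
    · refine ⟨x, z, hxz, hx, hzS, ?_⟩
      rw [SimpleGraph.dist_self, zero_add, hn, hz, add_comm]

theorem IsMedian.dist_adj (hZ : IsMedian Z) (hab : Z.Adj a b) (x : V) :
    Z.dist x b = Z.dist x a + 1 ∨ Z.dist x a = Z.dist x b + 1 := by
  obtain ⟨m, ⟨hxa, hm, hxb⟩, -⟩ := hZ.2 x a b
  have hab1 : Z.dist a b = 1 := SimpleGraph.dist_eq_one_iff_adj.2 hab
  rcases (by omega : Z.dist a m = 0 ∨ Z.dist m b = 0) with h | h <;>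
    obtain rfl := hZ.1.dist_eq_zero_iff.1 h
  · exact Or.inl (hab1 ▸ hxb)
  · exact Or.inr (SimpleGraph.dist_eq_one_iff_adj.2 hab.symm ▸ hxa)

theorem IsMedian.dist_eq_two (hZ : IsMedian Z) (hab : Z.Adj a b) (hbc : Z.Adj b c)
    (hac : a ≠ c) : Z.dist a c = 2 := by
  have h := hZ.dist_adj hbc a
  have h1 := SimpleGraph.dist_eq_one_iff_adj.2 hab
  have h0 : Z.dist a c ≠ 0 := fun h => hac (hZ.1.dist_eq_zero_iff.1 h)
  omega

/-- The vertices that are nearer to `a` than to `b`. If `a` and `b` are adjacent, this is the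
halfspace containing `a` of the hyperplane dual to the edge from `a` to `b`. -/
def nearer (Z : SimpleGraph V) (a b : V) : Set V := {x | Z.dist x a < Z.dist x b}

theorem left_mem_nearer (hab : Z.Adj a b) : a ∈ nearer Z a b := by
  simp [nearer, SimpleGraph.dist_eq_one_iff_adj.2 hab]

theorem IsMedian.notMem_nearer_iff (hZ : IsMedian Z) (hab : Z.Adj a b) :
    x ∉ nearer Z a b ↔ x ∈ nearer Z b a := by
  have := hZ.dist_adj hab x
  simp only [nearer, Set.mem_ofPred_eq]
  omega

theorem IsMedian.compl_nearer (hZ : IsMedian Z) (hab : Z.Adj a b) :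
    (nearer Z a b)ᶜ = nearer Z b a :=
  Set.ext fun _ => hZ.notMem_nearer_iff hab

theorem Opposite.symm (h : Opposite Z p q) : Opposite Z q p :=
  ⟨h.2.1, h.1, h.2.2.1.symm, h.2.2.2.1.symm, h.2.2.2.2.2.symm, h.2.2.2.2.1.symm⟩

theorem Opposite.swap (h : Opposite Z p q) : Opposite Z p.swap q.swap :=
  ⟨h.1.symm, h.2.1.symm, h.2.2.2.1, h.2.2.1, h.2.2.2.2.2, h.2.2.2.2.1⟩

theorem Opposite.transpose (h : Opposite Z (a, b) (c, d)) : Opposite Z (a, c) (b, d) :=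
  ⟨h.2.2.1, h.2.2.2.1, h.1, h.2.1, h.2.2.2.2.1, h.2.2.2.2.2.symm⟩

theorem IsMedian.nearer_subset_of_opposite (hZ : IsMedian Z) (h : Opposite Z (a, b) (c, d)) :
    nearer Z a b ⊆ nearer Z c d := by
  obtain ⟨hab, hcd, hac, hbd, had, hbc⟩ := h
  simp only at hab hcd hac hbd had hbc
  intro x hx
  simp only [nearer, Set.mem_ofPred_eq] at hx ⊢
  by_contra hn
  -- Otherwise `a` and `d` are both medians of `x`, `b` and `c`.
  have dcd := hZ.dist_adj hcd x
  have dac := hZ.dist_adj hac x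
  have dbd := hZ.dist_adj hbd x
  have hbc2 := hZ.dist_eq_two hab.symm hac hbc
  refine had ((hZ.2 x b c).unique ⟨?_, ?_, ?_⟩ ⟨?_, ?_, ?_⟩) <;>
    simp only [SimpleGraph.dist_eq_one_iff_adj.2, hab, hab.symm, hac, hbd, hbd.symm, hcd.symm] <;>
    omega

theorem IsMedian.nearer_eq_of_opposite (hZ : IsMedian Z) (h : Opposite Z (a, b) (c, d)) :
    nearer Z a b = nearer Z c d :=
  (hZ.nearer_subset_of_opposite h).antisymm (hZ.nearer_subset_of_opposite h.symm)

theorem IsMedian.exists_opposite (hZ : IsMedian Z) (hab : Z.Adj a b) (hac : Z.Adj a c)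
    (hbc : b ≠ c) (hb : x ∈ nearer Z b a) (hc : x ∈ nearer Z c a) :
    ∃ d, Opposite Z (a, b) (c, d) := by
  simp only [nearer, Set.mem_ofPred_eq] at hb hc
  have hxb := hZ.dist_adj hab x
  have hxc := hZ.dist_adj hac x
  have hbc2 := hZ.dist_eq_two hab.symm hac hbc
  obtain ⟨d, ⟨hxb', hbc', hxc'⟩, -⟩ := hZ.2 x b c
  have hbd := Z.dist_comm (u := b) (v := d)
  have hcd := Z.dist_comm (u := c) (v := d)
  refine ⟨d, hab, SimpleGraph.dist_eq_one_iff_adj.1 (by omega : Z.dist c d = 1), hac,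
    SimpleGraph.dist_eq_one_iff_adj.1 (by omega : Z.dist b d = 1), ?_, hbc⟩
  rintro (rfl : a = d)
  omega

theorem IsMedian.reflTransGen_opposite_of_mem_nearer (hZ : IsMedian Z) (hab : Z.Adj a b)
    (hcd : Z.Adj c d) (hc : c ∈ nearer Z a b) (hd : d ∈ nearer Z b a) :
    Relation.ReflTransGen (Opposite Z) (a, b) (c, d) := by
  obtain ⟨n, hn⟩ : ∃ n, Z.dist a c = n := ⟨_, rfl⟩
  induction n generalizing a b with
  | zero =>
    obtain rfl := hZ.1.dist_eq_zero_iff.1 hn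
    simp only [nearer, Set.mem_ofPred_eq, SimpleGraph.dist_eq_one_iff_adj.2 hcd.symm] at hd
    obtain rfl := hZ.1.dist_eq_zero_iff.1 (Nat.lt_one_iff.1 hd)
    exact Relation.ReflTransGen.refl
  | succ n ih =>
    obtain ⟨a', haa', ha'⟩ := exists_adj_dist_eq hZ.1 hn
    have hne : b ≠ a' := by
      rintro rfl
      simp only [nearer, Set.mem_ofPred_eq, Z.dist_comm (u := c)] at hc
      omega
    have hda' : d ∈ nearer Z a' a := by
      have hcb := hZ.dist_adj hab c
      have hdb := hZ.dist_adj hcd b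
      have hda := hZ.dist_adj hcd a'
      simp only [nearer, Set.mem_ofPred_eq, Z.dist_comm (u := c), Z.dist_comm (u := d)] at *
      omega
    obtain ⟨b', hop⟩ := hZ.exists_opposite hab haa' hne hd hda'
    exact .head hop (ih hop.2.1 (hZ.nearer_eq_of_opposite hop ▸ hc)
      (hZ.nearer_eq_of_opposite hop.swap ▸ hd) ha')

end Median

/-! ## Hyperplanes and halfspaces -/

section Hyperplane

variable {V : Type u} {Z : SimpleGraph V} {H K : Set (V × V)} {S T : Set V} {a b x y z : V}
  {p q : V × V}

/-- The hyperplane dual to the edge `p`. -/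
def dualHyperplane (Z : SimpleGraph V) (p : V × V) : Set (V × V) := {q | Parallel Z p q}

theorem Parallel.swap (p : V × V) : Parallel Z p p.swap := Relation.EqvGen.rel _ _ (Or.inr rfl)

theorem Parallel.adj_iff (h : Parallel Z p q) : Z.Adj p.1 p.2 ↔ Z.Adj q.1 q.2 := by
  induction h with
  | rel p q h =>
    rcases h with h | rfl
    · exact iff_of_true h.1 h.2.1
    · exact Z.adj_comm _ _
  | refl p => exact Iff.rfl
  | symm p q _ ih => exact ih.symm
  | trans p q r _ _ ih₁ ih₂ => exact ih₁.trans ih₂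

theorem isHyperplane_dualHyperplane (hab : Z.Adj a b) :
    IsHyperplane Z (dualHyperplane Z (a, b)) := ⟨(a, b), hab, rfl⟩

theorem IsHyperplane.nonempty (hH : IsHyperplane Z H) : ∃ x y, (x, y) ∈ H := by
  obtain ⟨p, -, rfl⟩ := hH
  exact ⟨p.1, p.2, Relation.EqvGen.refl _⟩

theorem IsHyperplane.adj (hH : IsHyperplane Z H) (h : (x, y) ∈ H) : Z.Adj x y := by
  obtain ⟨p, hp, rfl⟩ := hH
  exact (Parallel.adj_iff h).1 hp

theorem IsHyperplane.swap_mem (hH : IsHyperplane Z H) (h : (x, y) ∈ H) : (y, x) ∈ H := by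
  obtain ⟨p, -, rfl⟩ := hH
  exact Relation.EqvGen.trans _ _ _ h (Parallel.swap _)

theorem IsHyperplane.mem_of_opposite (hH : IsHyperplane Z H) (hp : p ∈ H)
    (h : Opposite Z p q) : q ∈ H := by
  obtain ⟨r, -, rfl⟩ := hH
  exact Relation.EqvGen.trans _ _ _ hp (Relation.EqvGen.rel _ _ (Or.inl h))

theorem IsHyperplane.eq_dualHyperplane (hH : IsHyperplane Z H) (h : p ∈ H) :
    H = dualHyperplane Z p := by
  obtain ⟨r, -, rfl⟩ := hH
  ext q
  exact ⟨fun h' => Relation.EqvGen.trans _ _ _ (Relation.EqvGen.symm _ _ h) h',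
    fun h' => Relation.EqvGen.trans _ _ _ h h'⟩

theorem IsHyperplane.eq_of_mem (hH : IsHyperplane Z H) (hK : IsHyperplane Z K) (hp : p ∈ H)
    (hp' : p ∈ K) : H = K :=
  (hH.eq_dualHyperplane hp).trans (hK.eq_dualHyperplane hp').symm

theorem dualHyperplane_swap (hab : Z.Adj a b) :
    dualHyperplane Z (a, b) = dualHyperplane Z (b, a) :=
  (isHyperplane_dualHyperplane hab).eq_dualHyperplane (Parallel.swap _)

theorem IsMedian.pair_nearer_eq_of_parallel (hZ : IsMedian Z) (h : Parallel Z p q) :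
    ({nearer Z p.1 p.2, nearer Z p.2 p.1} : Set (Set V)) =
      {nearer Z q.1 q.2, nearer Z q.2 q.1} := by
  induction h with
  | rel p q h =>
    rcases h with h | rfl
    · rw [hZ.nearer_eq_of_opposite h, hZ.nearer_eq_of_opposite h.swap]
    · exact Set.pair_comm _ _
  | refl p => rfl
  | symm p q _ ih => exact ih.symm
  | trans p q r _ _ ih₁ ih₂ => exact ih₁.trans ih₂

theorem parallel_of_reflTransGen_opposite (h : Relation.ReflTransGen (Opposite Z) p q) :
    Parallel Z p q := by
  induction h with
  | refl => exact Relation.EqvGen.refl _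
  | tail _ h ih => exact Relation.EqvGen.trans _ _ _ ih (Relation.EqvGen.rel _ _ (Or.inl h))

theorem IsMedian.mem_dualHyperplane_iff (hZ : IsMedian Z) (hab : Z.Adj a b) :
    (x, y) ∈ dualHyperplane Z (a, b) ↔
      Z.Adj x y ∧ (x ∈ nearer Z a b ↔ y ∉ nearer Z a b) := by
  constructor
  · intro h
    have hxy : Z.Adj x y := (Parallel.adj_iff h).1 hab
    have hx := left_mem_nearer hxy
    have hy := left_mem_nearer hxy.symm
    have hmem : nearer Z a b ∈ ({nearer Z x y, nearer Z y x} : Set (Set V)) :=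
      hZ.pair_nearer_eq_of_parallel h ▸ Set.mem_insert _ _
    refine ⟨hxy, ?_⟩
    rcases hmem with h | h <;> rw [h, hZ.notMem_nearer_iff] <;> try assumption
    · exact iff_of_true hx hy
    · exact iff_of_false ((hZ.notMem_nearer_iff hxy.symm).2 hx) ((hZ.notMem_nearer_iff hxy).2 hy)
    · exact hxy.symm
  · rintro ⟨hxy, h⟩
    by_cases hx : x ∈ nearer Z a b
    · exact parallel_of_reflTransGen_opposite (hZ.reflTransGen_opposite_of_mem_nearer hab hxy hx
        ((hZ.notMem_nearer_iff hab).1 (h.1 hx)))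
    · have hy : y ∈ nearer Z a b := not_not.1 (mt h.2 hx)
      exact (isHyperplane_dualHyperplane hab).swap_mem (parallel_of_reflTransGen_opposite
        (hZ.reflTransGen_opposite_of_mem_nearer hab hxy.symm hy ((hZ.notMem_nearer_iff hab).1 hx)))

theorem SameSide.symm (hH : IsHyperplane Z H) (h : SameSide Z H x y) : SameSide Z H y x := by
  induction h with
  | refl => exact Relation.ReflTransGen.refl
  | tail _ hab ih => exact .head ⟨hab.1.symm, mt hH.swap_mem hab.2⟩ ih

theorem IsMedian.sameSide_left (hZ : IsMedian Z) (hab : Z.Adj a b) (hx : x ∈ nearer Z a b) :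
    SameSide Z (dualHyperplane Z (a, b)) x a := by
  obtain ⟨n, hn⟩ : ∃ n, Z.dist x a = n := ⟨_, rfl⟩
  induction n generalizing x with
  | zero =>
    obtain rfl := hZ.1.dist_eq_zero_iff.1 hn
    exact Relation.ReflTransGen.refl
  | succ n ih =>
    obtain ⟨z, hxz, hz⟩ := exists_adj_dist_eq hZ.1 hn
    have hza : z ∈ nearer Z a b := by
      simp only [nearer, Set.mem_ofPred_eq] at hx ⊢
      have hb := hZ.dist_adj hxz b
      rw [Z.dist_comm (v := x), Z.dist_comm (v := z)] at hb
      omega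
    exact .head ⟨hxz, fun h => ((hZ.mem_dualHyperplane_iff hab).1 h).2.1 hx hza⟩ (ih hza hz)

theorem IsMedian.sameSide_iff (hZ : IsMedian Z) (hab : Z.Adj a b) :
    SameSide Z (dualHyperplane Z (a, b)) x y ↔ (x ∈ nearer Z a b ↔ y ∈ nearer Z a b) := by
  have hH := isHyperplane_dualHyperplane hab
  constructor
  · intro h
    induction h with
    | refl => exact Iff.rfl
    | @tail y z _ hyz ih =>
      rw [hZ.mem_dualHyperplane_iff hab] at hyz
      tauto
  · intro h
    by_cases hx : x ∈ nearer Z a b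
    · exact (hZ.sameSide_left hab hx).trans (SameSide.symm hH (hZ.sameSide_left hab (h.1 hx)))
    · have hy := mt h.2 hx
      rw [hZ.notMem_nearer_iff hab] at hx hy
      rw [dualHyperplane_swap hab] at hH ⊢
      exact (hZ.sameSide_left hab.symm hx).trans (SameSide.symm hH (hZ.sameSide_left hab.symm hy))

theorem IsMedian.exists_eq_nearer (hZ : IsMedian Z) (hH : IsHyperplane Z H)
    (hS : IsHalfspace Z H S) :
    ∃ a b, Z.Adj a b ∧ H = dualHyperplane Z (a, b) ∧ S = nearer Z a b := by
  obtain ⟨⟨a, b⟩, hab : Z.Adj a b, rfl⟩ := hH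
  obtain ⟨x, rfl⟩ := hS
  change ∃ c d, Z.Adj c d ∧ dualHyperplane Z (a, b) = _ ∧
    {y | SameSide Z (dualHyperplane Z (a, b)) x y} = _
  simp only [hZ.sameSide_iff hab]
  by_cases hx : x ∈ nearer Z a b
  · exact ⟨a, b, hab, rfl, by simp only [hx, true_iff, Set.ofPred_mem_eq]⟩
  · refine ⟨b, a, hab.symm, dualHyperplane_swap hab, ?_⟩
    simp only [hx, false_iff, hZ.notMem_nearer_iff hab, Set.ofPred_mem_eq]

theorem IsMedian.isHalfspace_nearer (hZ : IsMedian Z) (hab : Z.Adj a b) :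
    IsHalfspace Z (dualHyperplane Z (a, b)) (nearer Z a b) :=
  ⟨a, by simp only [hZ.sameSide_iff hab, left_mem_nearer hab, true_iff, Set.ofPred_mem_eq]⟩

theorem IsMedian.mem_hyperplane_iff (hZ : IsMedian Z) (hH : IsHyperplane Z H)
    (hS : IsHalfspace Z H S) : (x, y) ∈ H ↔ Z.Adj x y ∧ (x ∈ S ↔ y ∉ S) := by
  obtain ⟨a, b, hab, rfl, rfl⟩ := hZ.exists_eq_nearer hH hS
  exact hZ.mem_dualHyperplane_iff hab

theorem IsMedian.mem_iff_of_notMem (hZ : IsMedian Z) (hH : IsHyperplane Z H)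
    (hS : IsHalfspace Z H S) (hxy : Z.Adj x y) (h : (x, y) ∉ H) : x ∈ S ↔ y ∈ S := by
  rw [hZ.mem_hyperplane_iff hH hS] at h
  tauto

theorem IsMedian.isHalfspace_compl (hZ : IsMedian Z) (hH : IsHyperplane Z H)
    (hS : IsHalfspace Z H S) : IsHalfspace Z H Sᶜ := by
  obtain ⟨a, b, hab, rfl, rfl⟩ := hZ.exists_eq_nearer hH hS
  rw [hZ.compl_nearer hab, dualHyperplane_swap hab]
  exact hZ.isHalfspace_nearer hab.symm

theorem IsMedian.eq_or_eq_compl (hZ : IsMedian Z) (hH : IsHyperplane Z H)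
    (hS : IsHalfspace Z H S) (hT : IsHalfspace Z H T) : T = S ∨ T = Sᶜ := by
  obtain ⟨a, b, hab, rfl, rfl⟩ := hZ.exists_eq_nearer hH hS
  obtain ⟨x, rfl⟩ := hT
  simp only [hZ.sameSide_iff hab]
  by_cases hx : x ∈ nearer Z a b
  · simp only [hx, true_iff, Set.ofPred_mem_eq, true_or]
  · simp only [hx, false_iff]
    exact Or.inr rfl

theorem IsMedian.eq_nearer (hZ : IsMedian Z) (hH : IsHyperplane Z H)
    (hS : IsHalfspace Z H S) (h : (x, y) ∈ H) (hx : x ∈ S) : S = nearer Z x y := by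
  have hxy := hH.adj h
  have hS' := hZ.isHalfspace_nearer hxy
  rw [← hH.eq_dualHyperplane h] at hS'
  rcases hZ.eq_or_eq_compl hH hS' hS with rfl | rfl
  · rfl
  · exact absurd (left_mem_nearer hxy) hx

theorem IsMedian.eq_of_mem_of_mem (hZ : IsMedian Z) (hH : IsHyperplane Z H)
    (hy : (x, y) ∈ H) (hz : (x, z) ∈ H) : y = z := by
  have hzy : z ∈ nearer Z y x := by
    rw [← hZ.notMem_nearer_iff (hH.adj hy)]
    rw [hH.eq_dualHyperplane hy, hZ.mem_dualHyperplane_iff (hH.adj hy)] at hz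
    exact hz.2.1 (left_mem_nearer (hH.adj hy))
  simp only [nearer, Set.mem_ofPred_eq, SimpleGraph.dist_eq_one_iff_adj.2 (hH.adj hz).symm] at hzy
  exact (hZ.1.dist_eq_zero_iff.1 (Nat.lt_one_iff.1 hzy)).symm

theorem IsMedian.reflTransGen_opposite (hZ : IsMedian Z) (hH : IsHyperplane Z H)
    (hS : IsHalfspace Z H S) {c d : V} (hab : (a, b) ∈ H) (hcd : (c, d) ∈ H) (ha : a ∈ S)
    (hc : c ∈ S) : Relation.ReflTransGen (Opposite Z) (a, b) (c, d) := by
  have hd : d ∉ S := ((hZ.mem_hyperplane_iff hH hS).1 hcd).2.1 hc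
  obtain rfl := hZ.eq_nearer hH hS hab ha
  exact hZ.reflTransGen_opposite_of_mem_nearer (hH.adj hab) (hH.adj hcd) hc
    ((hZ.notMem_nearer_iff (hH.adj hab)).1 hd)

theorem IsMedian.mem_of_dist_eq_add (hZ : IsMedian Z) (hH : IsHyperplane Z H)
    (hS : IsHalfspace Z H S) (hx : x ∈ S) (hy : y ∈ S)
    (hz : Z.dist x y = Z.dist x z + Z.dist z y) : z ∈ S := by
  by_contra hzS
  obtain ⟨c, d, hcd, hc, hd, h⟩ := exists_crossing hZ.1 hx hzS
  rw [hZ.eq_nearer hH hS ((hZ.mem_hyperplane_iff hH hS).2 ⟨hcd, by tauto⟩) hc, nearer,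
    Set.mem_ofPred_eq, Z.dist_comm, Z.dist_comm (v := d)] at hy
  have hxcy := hZ.1.dist_triangle (u := x) (v := c) (w := y)
  have hdzy := hZ.1.dist_triangle (u := d) (v := z) (w := y)
  omega

theorem IsMedian.exists_crossing_mem (hZ : IsMedian Z) (hH : IsHyperplane Z H)
    (hS : IsHalfspace Z H S) (hK : IsHyperplane Z K) (hT : IsHalfspace Z K T)
    (hx : x ∈ S) (hy : y ∉ S) (hxT : x ∈ T) (hyT : y ∈ T) :
    ∃ c d, (c, d) ∈ H ∧ c ∈ S ∧ d ∉ S ∧ c ∈ T ∧ d ∈ T := by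
  obtain ⟨c, d, hcd, hc, hd, h⟩ := exists_crossing hZ.1 hx hy
  have hcd1 := SimpleGraph.dist_eq_one_iff_adj.2 hcd
  have hxcy := hZ.1.dist_triangle (u := x) (v := c) (w := y)
  have hxdy := hZ.1.dist_triangle (u := x) (v := d) (w := y)
  have hcdy := hZ.1.dist_triangle (u := c) (v := d) (w := y)
  have hxcd := hZ.1.dist_triangle (u := x) (v := c) (w := d)
  exact ⟨c, d, (hZ.mem_hyperplane_iff hH hS).2 ⟨hcd, by tauto⟩, hc, hd,
    hZ.mem_of_dist_eq_add hK hT hxT hyT (by omega), hZ.mem_of_dist_eq_add hK hT hxT hyT (by omega)⟩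

theorem IsMedian.exists_separating (hZ : IsMedian Z) (h : x ≠ y) :
    ∃ H S, IsHyperplane Z H ∧ IsHalfspace Z H S ∧ x ∈ S ∧ y ∉ S := by
  obtain ⟨c, d, hcd, rfl, -, h⟩ := exists_crossing hZ.1 (Set.mem_singleton x) h.symm
  refine ⟨_, _, isHyperplane_dualHyperplane hcd, hZ.isHalfspace_nearer hcd,
    left_mem_nearer hcd, ?_⟩
  rw [SimpleGraph.dist_self] at h
  simp only [nearer, Set.mem_ofPred_eq, Z.dist_comm (u := y)]
  omega

theorem IsMedian.finite_separating (hZ : IsMedian Z) (x y : V) :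
    {S | (∃ H, IsHyperplane Z H ∧ IsHalfspace Z H S) ∧ x ∈ S ∧ y ∉ S}.Finite := by
  obtain ⟨n, hn⟩ : ∃ n, Z.dist x y = n := ⟨_, rfl⟩
  induction n generalizing x with
  | zero =>
    obtain rfl := hZ.1.dist_eq_zero_iff.1 hn
    exact Set.finite_empty.subset fun S hS => hS.2.2 hS.2.1
  | succ n ih =>
    obtain ⟨z, hxz, hz⟩ := exists_adj_dist_eq hZ.1 hn
    refine ((ih z hz).insert (nearer Z x z)).subset ?_
    rintro S ⟨⟨H, hH, hS⟩, hx, hy⟩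
    by_cases h : z ∈ S
    · exact Or.inr ⟨⟨H, hH, hS⟩, h, hy⟩
    · exact Or.inl (hZ.eq_nearer hH hS ((hZ.mem_hyperplane_iff hH hS).2 ⟨hxz, by tauto⟩) hx)

end Hyperplane

section Transverse

variable {V : Type u} {Z : SimpleGraph V} {H K : Set (V × V)} {S T : Set V}

theorem IsMedian.mem_iff_of_not_transverse (hZ : IsMedian Z) (hH : IsHyperplane Z H)
    (hK : IsHyperplane Z K) (hT : IsHalfspace Z K T) (hn : ¬ Transverse Z H K) {p q : V × V}
    (hp : p ∈ H) (h : Relation.ReflTransGen (Opposite Z) p q) : p.1 ∈ T ↔ q.1 ∈ T := by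
  suffices q ∈ H ∧ (p.1 ∈ T ↔ q.1 ∈ T) from this.2
  induction h with
  | refl => exact ⟨hp, Iff.rfl⟩
  | @tail q r _ hqr ih =>
    refine ⟨hH.mem_of_opposite ih.1 hqr, ih.2.trans ?_⟩
    exact hZ.mem_iff_of_notMem hK hT hqr.2.2.1 fun h => hn ⟨_, _, _, _, hqr, ih.1, h⟩

theorem IsMedian.carrier_subset_or (hZ : IsMedian Z) (hH : IsHyperplane Z H)
    (hK : IsHyperplane Z K) (hT : IsHalfspace Z K T) (hne : H ≠ K) (hn : ¬ Transverse Z H K) :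
    carrier H ⊆ T ∨ carrier H ⊆ Tᶜ := by
  obtain ⟨x, y, hxy⟩ := hH.nonempty
  have hS : IsHalfspace Z H {z | SameSide Z H x z} := ⟨x, rfl⟩
  have hx : x ∈ {z | SameSide Z H x z} := Relation.ReflTransGen.refl
  have hmem : ∀ z ∈ carrier H, x ∈ T ↔ z ∈ T := by
    rintro z ⟨w, hzw⟩
    have hadj := (hZ.mem_hyperplane_iff hH hS).1 hzw
    by_cases hz : z ∈ {z | SameSide Z H x z}
    · exact hZ.mem_iff_of_not_transverse hH hK hT hn hxy
        (hZ.reflTransGen_opposite hH hS hxy hzw hx hz)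
    · have hw := not_not.1 (mt hadj.2.2 hz)
      rw [hZ.mem_iff_of_notMem hK hT hadj.1 fun h => hne (hH.eq_of_mem hK hzw h)]
      exact hZ.mem_iff_of_not_transverse hH hK hT hn hxy
        (hZ.reflTransGen_opposite hH hS hxy (hH.swap_mem hzw) hx hw)
  by_cases hxT : x ∈ T
  · exact Or.inl fun z hz => (hmem z hz).1 hxT
  · exact Or.inr fun z hz => mt (hmem z hz).2 hxT

theorem Transverse.ne (hZ : IsMedian Z) (h : Transverse Z H K) (hH : IsHyperplane Z H) :
    H ≠ K := by
  rintro rfl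
  obtain ⟨a, b, c, d, h, hab, hac⟩ := h
  exact h.2.2.2.2.2 (hZ.eq_of_mem_of_mem hH hab hac)

theorem IsMedian.inter_nonempty_of_mem_carrier (hZ : IsMedian Z) (hH : IsHyperplane Z H)
    (hK : IsHyperplane Z K) (hne : H ≠ K) (hS : IsHalfspace Z H S) (hT : IsHalfspace Z K T)
    {x : V} (hx : x ∈ S) (hxK : x ∈ carrier K) : (S ∩ T).Nonempty := by
  obtain ⟨y, hxy⟩ := hxK
  have hadj := (hZ.mem_hyperplane_iff hK hT).1 hxy
  have hy : y ∈ S := (hZ.mem_iff_of_notMem hH hS hadj.1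
    fun h => hne (hH.eq_of_mem hK h hxy)).1 hx
  by_cases hxT : x ∈ T
  · exact ⟨x, hx, hxT⟩
  · exact ⟨y, hy, not_not.1 (mt hadj.2.2 hxT)⟩

theorem Transverse.inter_nonempty (hZ : IsMedian Z) (h : Transverse Z H K)
    (hH : IsHyperplane Z H) (hK : IsHyperplane Z K) (hS : IsHalfspace Z H S)
    (hT : IsHalfspace Z K T) : (S ∩ T).Nonempty := by
  have hne := h.ne hZ hH
  obtain ⟨a, b, c, d, h, hab, hac⟩ := h
  by_cases ha : a ∈ S
  · exact hZ.inter_nonempty_of_mem_carrier hH hK hne hS hT ha ⟨c, hac⟩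
  · have hb : b ∈ S := not_not.1 (mt ((hZ.mem_hyperplane_iff hH hS).1 hab).2.2 ha)
    exact hZ.inter_nonempty_of_mem_carrier hH hK hne hS hT hb
      ⟨d, hK.mem_of_opposite hac h.transpose⟩

theorem IsMedian.transverse_of_inter_nonempty (hZ : IsMedian Z)
    (hH : IsHyperplane Z H) (hK : IsHyperplane Z K) (hS : IsHalfspace Z H S)
    (hT : IsHalfspace Z K T) (h₁ : (S ∩ T).Nonempty) (h₂ : (S ∩ Tᶜ).Nonempty)
    (h₃ : (Sᶜ ∩ T).Nonempty) (h₄ : (Sᶜ ∩ Tᶜ).Nonempty) : Transverse Z H K := by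
  by_contra hn
  have hne : H ≠ K := by
    rintro rfl
    rcases hZ.eq_or_eq_compl hH hS hT with rfl | rfl
    · simp at h₂
    · simp at h₁
  rcases hZ.carrier_subset_or hH hK hT hne hn with h | h
  · obtain ⟨⟨x, hxS, hxT⟩, y, hyS, hyT⟩ := h₂, h₄
    obtain ⟨c, d, hcd, -, -, hc, -⟩ :=
      hZ.exists_crossing_mem hH hS hK (hZ.isHalfspace_compl hK hT) hxS hyS hxT hyT
    exact hc (h ⟨d, hcd⟩)
  · obtain ⟨⟨x, hxS, hxT⟩, y, hyS, hyT⟩ := h₁, h₃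
    obtain ⟨c, d, hcd, -, -, hc, -⟩ := hZ.exists_crossing_mem hH hS hK hT hxS hyS hxT hyT
    exact h ⟨d, hcd⟩ hc

end Transverse

section Isometric

variable {G : Type v} [Group G] {V : Type u} [MulAction G V] {Z : SimpleGraph V}
  {H K : Set (V × V)} {S : Set V}

theorem Opposite.smul (hG : IsIsometric G Z) (g : G) {p q : V × V} (h : Opposite Z p q) :
    Opposite Z (g • p) (g • q) :=
  ⟨(hG g _ _).2 h.1, (hG g _ _).2 h.2.1, (hG g _ _).2 h.2.2.1, (hG g _ _).2 h.2.2.2.1,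
    (MulAction.injective g).ne h.2.2.2.2.1, (MulAction.injective g).ne h.2.2.2.2.2⟩

theorem Transverse.smul (hG : IsIsometric G Z) (g : G) (h : Transverse Z H K) :
    Transverse Z (g • H) (g • K) := by
  obtain ⟨a, b, c, d, h, hab, hac⟩ := h
  exact ⟨g • a, g • b, g • c, g • d, h.smul hG g, Set.smul_mem_smul_set hab,
    Set.smul_mem_smul_set hac⟩

theorem IsMedian.smul_eq_of_inter_nonempty (hZ : IsMedian Z) (hG : IsIsometric G Z)
    (hH : IsHyperplane Z H) (hS : IsHalfspace Z H S) {g : G} (hg : g • H = H)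
    (h : (S ∩ g • S).Nonempty) : g • S = S := by
  have hgS := hS.smul hG g
  rw [hg] at hgS
  refine (hZ.eq_or_eq_compl hH hS hgS).resolve_right fun h' => ?_
  rw [h', Set.inter_compl_self] at h
  exact Set.not_nonempty_empty h

end Isometric

/-! ## Cells of the quotient -/

theorem FaceMap.edge_base {n : ℕ} (x : Fin n → Bool) (i : Fin n) :
    (FaceMap.edge x i).base = x := rfl

theorem FaceMap.edge_dir {n : ℕ} (x : Fin n → Bool) (i : Fin n) (k : Fin 1) :
    (FaceMap.edge x i).dir k = i := rfl

theorem FaceMap.app_edge {n : ℕ} (x : Fin n → Bool) (i : Fin n) (y : Fin 1 → Bool) (j : Fin n) :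
    (FaceMap.edge x i).app y j = xor (x j) (if j = i then y 0 else false) := by
  by_cases h : j = i
  · subst h
    rw [if_pos rfl]
    exact FaceMap.app_dir (FaceMap.edge x j) y 0
  · rw [FaceMap.app_of_not _ _ _ fun ⟨_, hk⟩ => h hk.symm, if_neg h, Bool.xor_false]
    rfl

section Cells

variable {V : Type u} {Z : SimpleGraph V}

theorem isCube_const (x : V) : IsCube Z fun _ : Fin 0 → Bool => x := fun _ _ => by
  simp [hammingDist]

/-- The parametrization of the edge from `a` to `b`. -/
def edgeMap (a b : V) (x : Fin 1 → Bool) : V := if x 0 then b else a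

theorem eq_edgeMap (c : (Fin 1 → Bool) → V) :
    c = edgeMap (c fun _ => false) (c fun _ => true) := by
  funext x
  rw [eq_const_of_unique x]
  rcases x default <;> simp [edgeMap, Function.const_def]

theorem isCube_edgeMap {a b : V} (h : Z.Adj a b) : IsCube Z (edgeMap a b) := by
  have hab := SimpleGraph.dist_eq_one_iff_adj.2 h
  have hba := SimpleGraph.dist_eq_one_iff_adj.2 h.symm
  intro x y
  rcases hx : x 0 <;> rcases hy : y 0 <;>
    simp [edgeMap, hammingDist, hx, hy, hab, hba, Finset.filter_singleton]

theorem IsCube.adj {c : (Fin 1 → Bool) → V} (hc : IsCube Z c) :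
    Z.Adj (c fun _ => false) (c fun _ => true) :=
  SimpleGraph.dist_eq_one_iff_adj.1 <| (hc _ _).trans (by decide)

/-- The parametrization of the square with corners `a`, `b`, `c`, `d`, the first axis being the edge
from `a` to `b` and the second one the edge from `a` to `c`. -/
def squareMap (a b c d : V) (x : Fin 2 → Bool) : V :=
  if x 0 then (if x 1 then d else b) else (if x 1 then c else a)

theorem eq_squareMap (c : (Fin 2 → Bool) → V) :
    c = squareMap (c ![false, false]) (c ![true, false]) (c ![false, true]) (c ![true, true]) := by
  funext x
  rw [show x = ![x 0, x 1] from funext (Fin.forall_fin_two.2 ⟨rfl, rfl⟩)]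
  rcases x 0 <;> rcases x 1 <;> simp [squareMap]

theorem IsMedian.isCube_squareMap (hZ : IsMedian Z) {a b c d : V}
    (h : Opposite Z (a, b) (c, d)) : IsCube Z (squareMap a b c d) := by
  obtain ⟨hab, hcd, hac, hbd, had, hbc⟩ := h
  have hamming (x y : Fin 2 → Bool) :
      hammingDist x y = (if x 0 = y 0 then 0 else 1) + (if x 1 = y 1 then 0 else 1) := by
    simp only [hammingDist, Finset.card_filter, Fin.sum_univ_two, ne_eq, ite_not]
  intro x y
  rw [hamming]
  rcases hx : x 0 <;> rcases hy : y 0 <;> rcases hx' : x 1 <;> rcases hy' : y 1 <;>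
    simp [squareMap, hx, hy, hx', hy', SimpleGraph.dist_eq_one_iff_adj.2 hab,
      SimpleGraph.dist_eq_one_iff_adj.2 hab.symm, SimpleGraph.dist_eq_one_iff_adj.2 hcd,
      SimpleGraph.dist_eq_one_iff_adj.2 hcd.symm, SimpleGraph.dist_eq_one_iff_adj.2 hac,
      SimpleGraph.dist_eq_one_iff_adj.2 hac.symm, SimpleGraph.dist_eq_one_iff_adj.2 hbd,
      SimpleGraph.dist_eq_one_iff_adj.2 hbd.symm, hZ.dist_eq_two hab hbd had,
      hZ.dist_eq_two hbd.symm hab.symm had.symm, hZ.dist_eq_two hab.symm hac hbc,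
      hZ.dist_eq_two hac.symm hab hbc.symm]

theorem IsCube.opposite {c : (Fin 2 → Bool) → V} (hc : IsCube Z c) :
    Opposite Z (c ![false, false], c ![true, false]) (c ![false, true], c ![true, true]) := by
  have adj {x y} (h : hammingDist x y = 1) : Z.Adj (c x) (c y) :=
    SimpleGraph.dist_eq_one_iff_adj.1 ((hc x y).trans h)
  have ne {x y} (h : hammingDist x y = 2) : c x ≠ c y := fun h' => by
    have := hc x y
    rw [h', SimpleGraph.dist_self, h] at this
    exact absurd this (by decide)
  exact ⟨adj (by decide), adj (by decide), adj (by decide), adj (by decide), ne (by decide),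
    ne (by decide)⟩

variable (G : Type v) [Group G] [MulAction G V]

/-- The image of a cube of `Z` in the quotient. -/
def cell {n : ℕ} {c : (Fin n → Bool) → V} (hc : IsCube Z c) : (quotient G Z).Cell n :=
  Quot.mk _ ⟨c, hc⟩

/-- The image of a vertex of `Z` in the quotient. -/
def vertexCell (Z : SimpleGraph V) (x : V) : (quotient G Z).Cell 0 :=
  cell G (isCube_const (Z := Z) x)

/-- The image of an oriented edge of `Z` in the quotient. -/
def edgeCell {a b : V} (h : Z.Adj a b) : (quotient G Z).Cell 1 := cell G (isCube_edgeMap h)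

/-- The image of a square of `Z` in the quotient. -/
def squareCell (hZ : IsMedian Z) {a b c d : V} (h : Opposite Z (a, b) (c, d)) :
    (quotient G Z).Cell 2 := cell G (hZ.isCube_squareMap h)

variable {G}

theorem exists_cell_eq {n : ℕ} (q : (quotient G Z).Cell n) :
    ∃ (c : (Fin n → Bool) → V) (hc : IsCube Z c), cell G hc = q := by
  obtain ⟨⟨c, hc⟩, h⟩ := Quot.exists_rep q
  exact ⟨c, hc, h⟩

theorem cell_congr {n : ℕ} {c c' : (Fin n → Bool) → V} (hc : IsCube Z c) (hc' : IsCube Z c')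
    (h : c = c') : cell G hc = cell G hc' := by
  subst h
  rfl

theorem cell_eq_iff {n : ℕ} {c c' : (Fin n → Bool) → V} (hc : IsCube Z c) (hc' : IsCube Z c') :
    cell G hc = cell G hc' ↔ ∃ g : G, ∀ x, g • c x = c' x := by
  refine Equivalence.quot_mk_eq_iff ⟨?_, ?_, ?_⟩ _ _
  · exact fun c => ⟨1, fun x => one_smul _ _⟩
  · rintro c c' ⟨g, h⟩
    exact ⟨g⁻¹, fun x => by rw [← h, inv_smul_smul]⟩
  · rintro c c' c'' ⟨g, h⟩ ⟨g', h'⟩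
    exact ⟨g' * g, fun x => by rw [mul_smul, h, h']⟩

theorem exists_vertexCell_eq (q : (quotient G Z).Cell 0) : ∃ x, vertexCell G Z x = q := by
  obtain ⟨c, hc, rfl⟩ := exists_cell_eq q
  exact ⟨c Fin.elim0, cell_congr _ _ (funext fun x => by rw [Subsingleton.elim x Fin.elim0])⟩

theorem vertexCell_eq_iff {x y : V} :
    vertexCell G Z x = vertexCell G Z y ↔ ∃ g : G, g • x = y :=
  (cell_eq_iff _ _).trans <| exists_congr fun _ => ⟨fun h => h Fin.elim0, fun h _ => h⟩

theorem exists_edgeCell_eq (q : (quotient G Z).Cell 1) :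
    ∃ a b, ∃ h : Z.Adj a b, edgeCell G h = q := by
  obtain ⟨c, hc, rfl⟩ := exists_cell_eq q
  exact ⟨_, _, hc.adj, cell_congr _ _ (eq_edgeMap c).symm⟩

theorem edgeCell_eq_iff {a b a' b' : V} (h : Z.Adj a b) (h' : Z.Adj a' b') :
    edgeCell G h = edgeCell G h' ↔ ∃ g : G, g • a = a' ∧ g • b = b' := by
  rw [edgeCell, edgeCell, cell_eq_iff]
  constructor
  · rintro ⟨g, hg⟩
    exact ⟨g, by simpa [edgeMap] using hg fun _ => false, by simpa [edgeMap] using hg fun _ => true⟩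
  · rintro ⟨g, h1, h2⟩
    refine ⟨g, fun x => ?_⟩
    rcases hx : x 0 <;> simp [edgeMap, hx, h1, h2]

theorem face_cell_eq_edgeCell {n : ℕ} {c : (Fin n → Bool) → V} (hc : IsCube Z c) (f : FaceMap 1 n)
    {a b : V} (h : Z.Adj a b) (ha : c (f.app fun _ => false) = a)
    (hb : c (f.app fun _ => true) = b) :
    (quotient G Z).face f (cell G hc) = edgeCell G h := by
  subst ha hb
  exact cell_congr _ _ (eq_edgeMap fun x => c (f.app x))

theorem origin_edgeCell {a b : V} (h : Z.Adj a b) :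
    (quotient G Z).origin (edgeCell G h) = vertexCell G Z a := by
  refine cell_congr _ _ (funext fun x => ?_)
  have : (FaceMap.vertex fun _ : Fin 1 => false).app x = fun _ => false :=
    funext fun j => FaceMap.app_of_not _ _ _ fun ⟨i, _⟩ => i.elim0
  simp [this, edgeMap]

theorem reverse_edgeCell {a b : V} (h : Z.Adj a b) :
    (quotient G Z).reverse (edgeCell G h) = edgeCell G h.symm := by
  refine face_cell_eq_edgeCell (isCube_edgeMap h) _ _ ?_ ?_ <;>
    simp [edgeMap, FaceMap.rev, FaceMap.app_edge]

section Squares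

variable (hZ : IsMedian Z) {a b c d : V} (h : Opposite Z (a, b) (c, d))
include hZ h

theorem face_squareCell_left : (quotient G Z).face (FaceMap.edge ![false, false] 0)
    (squareCell G hZ h) = edgeCell G h.1 := by
  refine face_cell_eq_edgeCell _ _ _ ?_ ?_ <;> simp [squareMap, FaceMap.app_edge]

theorem face_squareCell_right : (quotient G Z).face (FaceMap.edge ![false, true] 0)
    (squareCell G hZ h) = edgeCell G h.2.1 := by
  refine face_cell_eq_edgeCell _ _ _ ?_ ?_ <;> simp [squareMap, FaceMap.app_edge]

theorem face_squareCell_side : (quotient G Z).face (FaceMap.edge ![false, false] 1)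
    (squareCell G hZ h) = edgeCell G h.2.2.1 := by
  refine face_cell_eq_edgeCell _ _ _ ?_ ?_ <;> simp [squareMap, FaceMap.app_edge]

end Squares

theorem exists_squareCell_eq (hZ : IsMedian Z) (hG : IsIsometric G Z) {a b : V} (hab : Z.Adj a b)
    (s : (quotient G Z).Cell 2)
    (hs : (quotient G Z).face (FaceMap.edge ![false, false] 0) s = edgeCell G hab) :
    ∃ c d, ∃ h : Opposite Z (a, b) (c, d), squareCell G hZ h = s := by
  obtain ⟨f, hf, rfl⟩ := exists_cell_eq s
  have hs' : squareCell G hZ hf.opposite = cell G hf := cell_congr _ _ (eq_squareMap f).symm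
  rw [← hs', face_squareCell_left, edgeCell_eq_iff] at hs
  obtain ⟨g, rfl, rfl⟩ := hs
  refine ⟨_, _, hf.opposite.smul hG g, hs' ▸ (cell_eq_iff _ _).2 ⟨g⁻¹, fun x => ?_⟩⟩
  rcases hx : x 0 <;> rcases hx' : x 1 <;> simp [squareMap, hx, hx']

theorem IsFree.eq_one_of_smul_eq (hf : IsFree G Z) {g : G} {x : V} (h : g • x = x) : g = 1 := by
  refine hf g 0 (fun _ => x) (isCube_const x) ?_
  rw [Set.range_const, Set.smul_set_singleton, h]

end Cells

/-! ## Labels of edges -/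

theorem salvetti_face_apply {W : Type*} (Γ : SimpleGraph W) {m n : ℕ} (f : FaceMap m n)
    (c : (salvetti Γ).Cell n) (i : Fin m) : ((salvetti Γ).face f c).1 i =
      ((c.1 (f.dir i)).1, xor (c.1 (f.dir i)).2 (f.base (f.dir i))) := rfl

theorem salvetti_edge_ext {W : Type*} {Γ : SimpleGraph W} {e e' : (salvetti Γ).Cell 1}
    (h : e.1 0 = e'.1 0) : e = e' :=
  Subtype.ext <| funext fun i => by rw [Subsingleton.elim i 0, h]

section Label

variable {V : Type u} {Z : SimpleGraph V} {G : Type v} [Group G] [MulAction G V] {W : Type*}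
  {Γ : SimpleGraph W} (Φ : CubicalSet.Iso (quotient G Z) (salvetti Γ))

/-- The generator, with an orientation, labelling the image of an oriented edge of `Z` in the
Salvetti complex. -/
def label {a b : V} (h : Z.Adj a b) : W × Bool := (Φ.equiv 1 (edgeCell G h)).1 0

theorem label_eq_iff {a b a' b' : V} (h : Z.Adj a b) (h' : Z.Adj a' b') :
    label Φ h = label Φ h' ↔ ∃ g : G, g • a = a' ∧ g • b = b' := by
  rw [← edgeCell_eq_iff h h', ← (Φ.equiv 1).injective.eq_iff]
  exact ⟨salvetti_edge_ext, fun he => by rw [label, he, label]⟩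

theorem label_swap {a b : V} (h : Z.Adj a b) :
    label Φ h.symm = ((label Φ h).1, !(label Φ h).2) := by
  rw [label, ← reverse_edgeCell h, CubicalSet.reverse, Φ.map_face, salvetti_face_apply]
  simp [label, FaceMap.rev, FaceMap.edge_dir, FaceMap.edge_base]

theorem label_eq_or_eq_symm {a b c d : V} (h : Z.Adj a b) (h' : Z.Adj c d)
    (hl : (label Φ h).1 = (label Φ h').1) :
    label Φ h = label Φ h' ∨ label Φ h.symm = label Φ h' := by
  by_cases hs : (label Φ h).2 = (label Φ h').2
  · exact Or.inl (Prod.ext hl hs)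
  · rw [label_swap Φ h]
    exact Or.inr (Prod.ext hl (Bool.not_eq.2 hs))

theorem Opposite.label_eq (hZ : IsMedian Z) {a b c d : V} (h : Opposite Z (a, b) (c, d)) :
    label Φ h.1 = label Φ h.2.1 := by
  rw [label, label, ← face_squareCell_left hZ h, ← face_squareCell_right hZ h, Φ.map_face,
    Φ.map_face, salvetti_face_apply, salvetti_face_apply]
  simp [FaceMap.edge_dir, FaceMap.edge_base]

theorem Opposite.adj_label (hZ : IsMedian Z) {a b c d : V} (h : Opposite Z (a, b) (c, d)) :
    Γ.Adj (label Φ h.1).1 (label Φ h.2.2.1).1 := by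
  rw [label, label, ← face_squareCell_left hZ h, ← face_squareCell_side hZ h, Φ.map_face,
    Φ.map_face]
  exact (Φ.equiv 2 (squareCell G hZ h)).2 0 1 (by simp)

include Φ in
theorem exists_smul_eq_of_iso (x y : V) : ∃ g : G, g • x = y :=
  vertexCell_eq_iff.1 <| (Φ.equiv 0).injective <| Subtype.ext <| funext fun i => i.elim0

theorem eq_of_label_eq (hf : IsFree G Z) {x y z : V} (hy : Z.Adj x y) (hz : Z.Adj x z)
    (h : label Φ hy = label Φ hz) : y = z := by
  obtain ⟨g, hx, rfl⟩ := (label_eq_iff Φ _ _).1 h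
  rw [hf.eq_one_of_smul_eq hx, one_smul]

theorem exists_opposite_of_adj_label (hZ : IsMedian Z) (hG : IsIsometric G Z) (hf : IsFree G Z)
    {x y z : V} (hy : Z.Adj x y) (hz : Z.Adj x z)
    (h : Γ.Adj (label Φ hy).1 (label Φ hz).1) : ∃ w, Opposite Z (x, y) (z, w) := by
  let s : (salvetti Γ).Cell 2 := ⟨![label Φ hy, label Φ hz], fun i j hij => by
    fin_cases i <;> fin_cases j <;> simp_all [h.symm]⟩
  obtain ⟨c, w, hop, hs⟩ := exists_squareCell_eq hZ hG hy ((Φ.equiv 2).symm s) <|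
    (Φ.equiv 1).injective <| salvetti_edge_ext <| by
      rw [Φ.map_face, Equiv.apply_symm_apply, salvetti_face_apply]
      simp [FaceMap.edge_dir, FaceMap.edge_base, s, label]
  have hlabel : label Φ hop.2.2.1 = label Φ hz := by
    rw [label, ← face_squareCell_side hZ hop, Φ.map_face, hs, Equiv.apply_symm_apply,
      salvetti_face_apply]
    simp [FaceMap.edge_dir, FaceMap.edge_base, s]
  obtain rfl := eq_of_label_eq Φ hf _ _ hlabel
  exact ⟨w, hop⟩

end Label

/-! ## Collapses -/

section Dual

variable {E : Type u} {𝓢 : Set (Set E)} {ρ σ τ υ : DualVertex 𝓢} {h : Set E}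

theorem DualVertex.eq_of_sdiff (hτ : σ.parts \ τ.parts = {h}) (hτ' : τ.parts \ σ.parts = {hᶜ})
    (hυ : σ.parts \ υ.parts = {h}) (hυ' : υ.parts \ σ.parts = {hᶜ}) : τ = υ := by
  refine DualVertex.ext (Set.ext fun k => ?_)
  have e₁ := Set.ext_iff.1 hτ k
  have e₂ := Set.ext_iff.1 hτ' k
  have e₃ := Set.ext_iff.1 hυ k
  have e₄ := Set.ext_iff.1 hυ' k
  simp only [Set.mem_sdiff, Set.mem_singleton_iff] at e₁ e₂ e₃ e₄
  tauto

theorem DualVertex.compl_mem_of_opposite (hop : Opposite (dualGraph 𝓢) (σ, τ) (υ, ρ))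
    (hτ : σ.parts \ τ.parts = {h}) (hτ' : τ.parts \ σ.parts = {hᶜ}) : hᶜ ∈ ρ.parts := by
  obtain ⟨-, -, -, ⟨k, hk, hk'⟩, hne, -⟩ := hop
  by_contra hρ
  have hmem : hᶜ ∈ τ.parts \ ρ.parts := ⟨(hτ'.ge rfl).1, hρ⟩
  obtain rfl : hᶜ = k := by rwa [hk] at hmem
  exact hne <| DualVertex.eq_of_sdiff hτ' (by rw [hτ, compl_compl]) hk hk'

end Dual

section CollapseMap

variable {V : Type u} {Z : SimpleGraph V} {𝓗 : Set (Set (V × V))} {H K : Set (V × V)} {S : Set V}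
  {x y z : V}

theorem IsMedian.exists_isHalfspace (hZ : IsMedian Z) (hH : IsHyperplane Z H) (h : (x, y) ∈ H) :
    ∃ S, IsHalfspace Z H S ∧ x ∈ S ∧ y ∉ S := by
  have hS : IsHalfspace Z H {z | SameSide Z H x z} := ⟨x, rfl⟩
  have hx : x ∈ {z | SameSide Z H x z} := Relation.ReflTransGen.refl
  exact ⟨_, hS, hx, ((hZ.mem_hyperplane_iff hH hS).1 h).2.1 hx⟩

/-- The restriction quotient collapsing `𝓗`: a vertex of `Z` is sent to the set of halfspaces
containing it. -/
def collapseMap (hZ : IsMedian Z) (𝓗 : Set (Set (V × V))) (x : V) :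
    DualVertex (remainingHalfspaces Z 𝓗) where
  parts := {S ∈ remainingHalfspaces Z 𝓗 | x ∈ S}
  subset S hS := hS.1
  choice := by
    rintro S ⟨H, hH, hn, hS⟩
    have hS' : IsHalfspace Z H Sᶜ := hZ.isHalfspace_compl hH hS
    by_cases hx : x ∈ S
    · exact Or.inl ⟨⟨⟨H, hH, hn, hS⟩, hx⟩, fun h => h.2 hx⟩
    · exact Or.inr ⟨⟨⟨H, hH, hn, hS'⟩, hx⟩, fun h => hx h.2⟩
  inter S hS T hT := ⟨x, hS.2, hT.2⟩
  finite y := by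
    refine (hZ.finite_separating x y).subset ?_
    rintro S ⟨⟨⟨H, hH, -, hS⟩, hx⟩, hy⟩
    exact ⟨⟨H, hH, hS⟩, hx, hy⟩

theorem collapseMap_sdiff (hZ : IsMedian Z) (hH : IsHyperplane Z H) (hn : H ∉ 𝓗)
    (hS : IsHalfspace Z H S) (h : (x, y) ∈ H) (hx : x ∈ S) :
    (collapseMap hZ 𝓗 x).parts \ (collapseMap hZ 𝓗 y).parts = {S} := by
  ext T
  constructor
  · rintro ⟨⟨⟨K, hK, hKn, hT⟩, hxT⟩, hyT⟩
    have hy : y ∉ T := fun hy => hyT ⟨⟨K, hK, hKn, hT⟩, hy⟩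
    have hxy : (x, y) ∈ K := (hZ.mem_hyperplane_iff hK hT).2 ⟨hH.adj h, by tauto⟩
    exact (hZ.eq_nearer hK hT hxy hxT).trans (hZ.eq_nearer hH hS h hx).symm
  · rintro rfl
    exact ⟨⟨⟨H, hH, hn, hS⟩, hx⟩, fun hy => ((hZ.mem_hyperplane_iff hH hS).1 h).2.1 hx hy.2⟩

theorem collapseMap_sdiff_compl (hZ : IsMedian Z) (hH : IsHyperplane Z H) (hn : H ∉ 𝓗)
    (hS : IsHalfspace Z H S) (h : (x, y) ∈ H) (hx : x ∈ S) :
    (collapseMap hZ 𝓗 y).parts \ (collapseMap hZ 𝓗 x).parts = {Sᶜ} :=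
  collapseMap_sdiff hZ hH hn (hZ.isHalfspace_compl hH hS) (hH.swap_mem h)
    (((hZ.mem_hyperplane_iff hH hS).1 h).2.1 hx)

theorem collapseMap_smul {G : Type v} [Group G] [MulAction G V] (hZ : IsMedian Z)
    (hG : IsIsometric G Z) (h𝓗 : IsInvariantFamily G Z 𝓗) (g : G) (x : V) :
    letI := collapseAction hG h𝓗
    collapseMap hZ 𝓗 (g • x) = g • collapseMap hZ 𝓗 x := by
  let := collapseAction hG h𝓗
  have hparts : (g • collapseMap hZ 𝓗 x).parts = g • (collapseMap hZ 𝓗 x).parts := rfl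
  refine DualVertex.ext (Set.ext fun S => ?_)
  rw [hparts, Set.mem_smul_set_iff_inv_smul_mem]
  refine and_congr ⟨remainingHalfspaces_smul hG h𝓗 g⁻¹ S, fun hS => ?_⟩
    Set.mem_inv_smul_set_iff.symm
  simpa only [smul_inv_smul] using remainingHalfspaces_smul hG h𝓗 g _ hS

theorem collapseMap_adj (hZ : IsMedian Z) (hH : IsHyperplane Z H) (hn : H ∉ 𝓗) (h : (x, y) ∈ H) :
    (collapse Z 𝓗).Adj (collapseMap hZ 𝓗 x) (collapseMap hZ 𝓗 y) := by
  obtain ⟨S, hS, hx, -⟩ := hZ.exists_isHalfspace hH h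
  exact ⟨S, collapseMap_sdiff hZ hH hn hS h hx, collapseMap_sdiff_compl hZ hH hn hS h hx⟩

theorem collapseMap_eq_of_mem (hZ : IsMedian Z) (hH : IsHyperplane Z H) (hm : H ∈ 𝓗)
    (h : (x, y) ∈ H) : collapseMap hZ 𝓗 x = collapseMap hZ 𝓗 y := by
  refine DualVertex.ext (Set.ext fun S => and_congr_right ?_)
  rintro ⟨K, hK, hn, hS⟩
  exact hZ.mem_iff_of_notMem hK hS (hH.adj h) fun h' => hn (hH.eq_of_mem hK h h' ▸ hm)

theorem mem_iff_of_collapseMap_eq (hZ : IsMedian Z) (hH : IsHyperplane Z H) (hn : H ∉ 𝓗)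
    (hS : IsHalfspace Z H S) (h : collapseMap hZ 𝓗 x = collapseMap hZ 𝓗 y) : x ∈ S ↔ y ∈ S := by
  have hS' : S ∈ remainingHalfspaces Z 𝓗 := ⟨H, hH, hn, hS⟩
  have hparts := Set.ext_iff.1 (congrArg DualVertex.parts h) S
  exact ⟨fun hx => (hparts.1 ⟨hS', hx⟩).2, fun hy => (hparts.2 ⟨hS', hy⟩).2⟩

theorem transverse_of_opposite_collapseMap (hZ : IsMedian Z)
    {w : DualVertex (remainingHalfspaces Z 𝓗)} (hH : IsHyperplane Z H) (hn : H ∉ 𝓗)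
    (hK : IsHyperplane Z K) (hn' : K ∉ 𝓗) (hy : (x, y) ∈ H) (hz : (x, z) ∈ K)
    (hop : Opposite (collapse Z 𝓗) (collapseMap hZ 𝓗 x, collapseMap hZ 𝓗 y)
      (collapseMap hZ 𝓗 z, w)) : Transverse Z H K := by
  obtain ⟨S, hS, hxS, hyS⟩ := hZ.exists_isHalfspace hH hy
  obtain ⟨T, hT, hxT, hzT⟩ := hZ.exists_isHalfspace hK hz
  have hne : H ≠ K := by
    rintro rfl
    exact hop.2.2.2.2.2 (congrArg (collapseMap hZ 𝓗) (hZ.eq_of_mem_of_mem hH hy hz))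
  have hyT : y ∈ T := (hZ.mem_iff_of_notMem hK hT (hH.adj hy)
    fun h => hne (hH.eq_of_mem hK hy h)).1 hxT
  have hzS : z ∈ S := (hZ.mem_iff_of_notMem hH hS (hK.adj hz)
    fun h => hne (hH.eq_of_mem hK h hz)).1 hxS
  have hwS : Sᶜ ∈ w.parts := DualVertex.compl_mem_of_opposite hop
    (collapseMap_sdiff hZ hH hn hS hy hxS) (collapseMap_sdiff_compl hZ hH hn hS hy hxS)
  have hwT : Tᶜ ∈ w.parts := DualVertex.compl_mem_of_opposite hop.transpose
    (collapseMap_sdiff hZ hK hn' hT hz hxT) (collapseMap_sdiff_compl hZ hK hn' hT hz hxT)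
  exact hZ.transverse_of_inter_nonempty hH hK hS hT ⟨x, hxS, hxT⟩ ⟨z, hzS, hzT⟩ ⟨y, hyS, hyT⟩
    (w.inter _ hwS _ hwT)

end CollapseMap

/-- `π : Z → Z'` has the properties of the strong collapse of the family `𝓗`, its source and its
range being `CAT(0)` cube complexes and the action on the range being free. The last five fields
are all that is used of Sageev's construction. -/
structure IsStrongCollapse {V V' : Type*} (G : Type*) [Group G] [MulAction G V] [MulAction G V']
    (Z : SimpleGraph V) (Z' : SimpleGraph V') (𝓗 : Set (Set (V × V))) (π : V → V') : Prop
    extends IsStronglyCollapsible G Z 𝓗 where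
  median : IsMedian Z
  isometric : IsIsometric G Z
  range : IsFreeCAT0Action G Z'
  map_smul : ∀ (g : G) (x : V), π (g • x) = g • π x
  adj : ∀ {H x y}, IsHyperplane Z H → H ∉ 𝓗 → (x, y) ∈ H → Z'.Adj (π x) (π y)
  map_eq : ∀ {H x y}, H ∈ 𝓗 → (x, y) ∈ H → π x = π y
  mem_iff : ∀ {H S x y}, IsHyperplane Z H → H ∉ 𝓗 → IsHalfspace Z H S → π x = π y →
    (x ∈ S ↔ y ∈ S)
  transverse : ∀ {H K x y z w}, IsHyperplane Z H → H ∉ 𝓗 → IsHyperplane Z K → K ∉ 𝓗 →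
    (x, y) ∈ H → (x, z) ∈ K → Opposite Z' (π x, π y) (π z, w) → Transverse Z H K

theorem isStrongCollapse_collapseMap {V : Type u} {G : Type v} [Group G] [MulAction G V]
    {Z : SimpleGraph V} {𝓗 : Set (Set (V × V))} (hZ : IsMedian Z) (hG : IsIsometric G Z)
    (h𝓗 : IsStronglyCollapsible G Z 𝓗)
    (hr : letI := collapseAction hG h𝓗.toIsInvariantFamily; IsFreeCAT0Action G (collapse Z 𝓗)) :
    letI := collapseAction hG h𝓗.toIsInvariantFamily
    IsStrongCollapse G Z (collapse Z 𝓗) 𝓗 (collapseMap hZ 𝓗) :=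
  letI := collapseAction hG h𝓗.toIsInvariantFamily
  { h𝓗 with
    median := hZ
    isometric := hG
    range := hr
    map_smul := collapseMap_smul hZ hG h𝓗.toIsInvariantFamily
    adj := collapseMap_adj hZ
    map_eq := fun hH => collapseMap_eq_of_mem hZ (h𝓗.hyperplane _ hH) hH
    mem_iff := mem_iff_of_collapseMap_eq hZ
    transverse := transverse_of_opposite_collapseMap hZ }

/-! ## Cospeciality -/

theorem IsInvariantFamily.smul_notMem {V : Type u} {Z : SimpleGraph V} {G : Type v} [Group G]
    [MulAction G V] {𝓗 : Set (Set (V × V))} {H : Set (V × V)} (h𝓗 : IsInvariantFamily G Z 𝓗)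
    (hn : H ∉ 𝓗) (g : G) : g • H ∉ 𝓗 := fun h =>
  hn (by simpa only [inv_smul_smul] using h𝓗.invariant g⁻¹ _ h)

namespace IsStrongCollapse

variable {V V' : Type u} {Z : SimpleGraph V} {Z' : SimpleGraph V'} {G : Type v} [Group G]
  [MulAction G V] [MulAction G V'] {𝓗 : Set (Set (V × V))} {π : V → V'} {H K : Set (V × V)}
  {S : Set V} {a b c d : V} {g : G} (hπ : IsStrongCollapse G Z Z' 𝓗 π)

section Map

include hπ

theorem eq_of_map_eq (hH : IsHyperplane Z H) (hn : H ∉ 𝓗) (hK : IsHyperplane Z K)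
    (hab : (a, b) ∈ H) (hcd : (c, d) ∈ K) (hac : π a = π c) (hbd : π b = π d) : H = K := by
  obtain ⟨S, hS, ha, hb⟩ := hπ.median.exists_isHalfspace hH hab
  rw [hπ.mem_iff hH hn hS hac] at ha
  rw [hπ.mem_iff hH hn hS hbd] at hb
  exact hH.eq_of_mem hK ((hπ.median.mem_hyperplane_iff hH hS).2 ⟨hK.adj hcd, by tauto⟩) hcd

theorem opposite_map (hH : IsHyperplane Z H) (hn : H ∉ 𝓗) (hK : IsHyperplane Z K) (hn' : K ∉ 𝓗)
    (h : Opposite Z (a, b) (c, d)) (hab : (a, b) ∈ H) (hac : (a, c) ∈ K) :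
    Opposite Z' (π a, π b) (π c, π d) := by
  obtain ⟨S, hS, ha, hb⟩ := hπ.median.exists_isHalfspace hH hab
  have hcd : (c, d) ∈ H := hH.mem_of_opposite hab h
  have hbd : (b, d) ∈ K := hK.mem_of_opposite hac h.transpose
  have hacH : (a, c) ∉ H := fun h' => h.2.2.2.2.2 (hπ.median.eq_of_mem_of_mem hH hab h')
  have hc : c ∈ S := (hπ.median.mem_iff_of_notMem hH hS h.2.2.1 hacH).1 ha
  have hd : d ∉ S := ((hπ.median.mem_hyperplane_iff hH hS).1 hcd).2.1 hc
  exact ⟨hπ.adj hH hn hab, hπ.adj hH hn hcd, hπ.adj hK hn' hac, hπ.adj hK hn' hbd,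
    fun h' => hd ((hπ.mem_iff hH hn hS h').1 ha), fun h' => hb ((hπ.mem_iff hH hn hS h').2 hc)⟩

theorem smul_eq_of_mem_carrier (hK : K ∈ 𝓗) (ha : a ∈ carrier K) (hb : b ∈ carrier (g • K))
    (hab : π a = π b) : g • K = K := by
  by_contra hne
  refine hπ.strong K hK g hne ?_
  rintro H ⟨hH, S, T, hS, hT, hST, hKS, hKT⟩
  by_contra hn
  have hb' : b ∈ S := (hπ.mem_iff hH hn hS hab).1 (hKS ha)
  obtain rfl : T = Sᶜ := (hπ.median.eq_or_eq_compl hH hS hT).resolve_left (Ne.symm hST)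
  exact hKT hb hb'

end Map

variable {W : Type*} {Γ : SimpleGraph W} (Φ : CubicalSet.Iso (quotient G Z') (salvetti Γ))

theorem label_eq_of_opposite (hH : IsHyperplane Z H) (hn : H ∉ 𝓗) (h : Opposite Z (a, b) (c, d))
    (hab : (a, b) ∈ H) (hcd : (c, d) ∈ H) :
    label Φ (hπ.adj hH hn hab) = label Φ (hπ.adj hH hn hcd) := by
  have hK : IsHyperplane Z (dualHyperplane Z (a, c)) := isHyperplane_dualHyperplane h.2.2.1
  have hac : (a, c) ∈ dualHyperplane Z (a, c) := Relation.EqvGen.refl _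
  by_cases hm : dualHyperplane Z (a, c) ∈ 𝓗
  · have hbd : (b, d) ∈ dualHyperplane Z (a, c) := hK.mem_of_opposite hac h.transpose
    exact (label_eq_iff Φ _ _).2
      ⟨1, by rw [one_smul, hπ.map_eq hm hac], by rw [one_smul, hπ.map_eq hm hbd]⟩
  · exact (hπ.opposite_map hH hn hK hm h hab hac).label_eq Φ hπ.range.median

theorem label_eq (hH : IsHyperplane Z H) (hn : H ∉ 𝓗) (hS : IsHalfspace Z H S)
    (hab : (a, b) ∈ H) (hcd : (c, d) ∈ H) (ha : a ∈ S) (hc : c ∈ S) :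
    label Φ (hπ.adj hH hn hab) = label Φ (hπ.adj hH hn hcd) := by
  suffices key : ∀ q, Relation.ReflTransGen (Opposite Z) (a, b) q → ∃ hq : (q.1, q.2) ∈ H,
      label Φ (hπ.adj hH hn hab) = label Φ (hπ.adj hH hn hq) from
    (key _ (hπ.median.reflTransGen_opposite hH hS hab hcd ha hc)).2
  intro q hq
  induction hq with
  | refl => exact ⟨hab, rfl⟩
  | tail _ h ih =>
    obtain ⟨hp, hl⟩ := ih
    have hq := hH.mem_of_opposite hp h
    exact ⟨hq, hl.trans (hπ.label_eq_of_opposite Φ hH hn h hp hq)⟩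

theorem label_smul_eq (hH : IsHyperplane Z H) (hn : H ∉ 𝓗) (hS : IsHalfspace Z H S)
    (hab : (a, b) ∈ H) (hcd : (c, d) ∈ g • H) (ha : a ∈ S) (hc : c ∈ g • S) :
    label Φ (hπ.adj hH hn hab) =
      label Φ (hπ.adj (hH.smul hπ.isometric g) (hπ.smul_notMem hn g) hcd) := by
  have hgab : (g • a, g • b) ∈ g • H := Set.smul_mem_smul_set hab
  rw [← hπ.label_eq Φ (hH.smul hπ.isometric g) (hπ.smul_notMem hn g) (hS.smul hπ.isometric g) hgab
    hcd (Set.smul_mem_smul_set ha) hc, label_eq_iff]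
  exact ⟨g, (hπ.map_smul g a).symm, (hπ.map_smul g b).symm⟩

theorem label_smul_fst_eq (g : G) (hH : IsHyperplane Z H) (hn : H ∉ 𝓗) (hab : (a, b) ∈ H)
    (hcd : (c, d) ∈ g • H) : (label Φ (hπ.adj hH hn hab)).1 =
      (label Φ (hπ.adj (hH.smul hπ.isometric g) (hπ.smul_notMem hn g) hcd)).1 := by
  obtain ⟨S, hS, ha, hb⟩ := hπ.median.exists_isHalfspace hH hab
  by_cases hc : c ∈ g • S
  · rw [hπ.label_smul_eq Φ hH hn hS hab hcd ha hc]
  · have hc' : c ∈ g • Sᶜ := by rwa [Set.smul_set_compl]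
    rw [← hπ.label_smul_eq Φ hH hn (hπ.median.isHalfspace_compl hH hS) (hH.swap_mem hab) hcd hb hc',
      label_swap Φ (hπ.adj hH hn hab)]

theorem label_fst_eq (hH : IsHyperplane Z H) (hn : H ∉ 𝓗) (hab : (a, b) ∈ H) (hcd : (c, d) ∈ H) :
    (label Φ (hπ.adj hH hn hab)).1 = (label Φ (hπ.adj hH hn hcd)).1 := by
  have hcd' : (c, d) ∈ (1 : G) • H := by rwa [one_smul]
  exact hπ.label_smul_fst_eq Φ 1 hH hn hab hcd'

theorem adj_label_of_transverse (hH : IsHyperplane Z H) (hn : H ∉ 𝓗) (hK : IsHyperplane Z K)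
    (hn' : K ∉ 𝓗) (h : Transverse Z H K) (hab : (a, b) ∈ H) (hcd : (c, d) ∈ K) :
    Γ.Adj (label Φ (hπ.adj hH hn hab)).1 (label Φ (hπ.adj hK hn' hcd)).1 := by
  obtain ⟨x, y, z, w, hop, hxy, hxz⟩ := h
  rw [hπ.label_fst_eq Φ hH hn hab hxy, hπ.label_fst_eq Φ hK hn' hcd hxz]
  exact (hπ.opposite_map hH hn hK hn' hop hxy hxz).adj_label Φ hπ.range.median

include hπ Φ

theorem smul_halfspace_eq (hH : IsHyperplane Z H) (hn : H ∉ 𝓗) (hS : IsHalfspace Z H S)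
    (hg : g • H = H) : g • S = S := by
  have hgS : IsHalfspace Z H (g • S) := by simpa only [hg] using hS.smul hπ.isometric g
  refine (hπ.median.eq_or_eq_compl hH hS hgS).resolve_right fun hcompl => ?_
  obtain ⟨a, b, hab, ha⟩ : ∃ a b, (a, b) ∈ H ∧ a ∈ S := by
    obtain ⟨x, y, hxy⟩ := hH.nonempty
    have hxyS := ((hπ.median.mem_hyperplane_iff hH hS).1 hxy).2
    by_cases hx : x ∈ S
    · exact ⟨x, y, hxy, hx⟩
    · exact ⟨y, x, hH.swap_mem hxy, not_not.1 (mt hxyS.2 hx)⟩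
  have hb : b ∈ g • S := hcompl ▸ ((hπ.median.mem_hyperplane_iff hH hS).1 hab).2.1 ha
  have hba : (b, a) ∈ g • H := hg.symm ▸ hH.swap_mem hab
  have hl := hπ.label_smul_eq Φ hH hn hS hab hba ha hb
  rw [label_swap Φ (hπ.adj hH hn hab)] at hl
  exact (Bool.not_ne_self _) (congrArg Prod.snd hl).symm

theorem not_transverse_smul (hH : IsHyperplane Z H) (hn : H ∉ 𝓗) : ¬ Transverse Z H (g • H) := by
  intro h
  obtain ⟨x, y, hxy⟩ := hH.nonempty
  have hgxy : (g • x, g • y) ∈ g • H := Set.smul_mem_smul_set hxy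
  exact (hπ.adj_label_of_transverse Φ hH hn (hH.smul hπ.isometric g) (hπ.smul_notMem hn g) h hxy
    hgxy).ne (hπ.label_smul_fst_eq Φ g hH hn hxy hgxy)

theorem inter_smul_nonempty (hH : IsHyperplane Z H) (hn : H ∉ 𝓗) (hS : IsHalfspace Z H S)
    (hc : (carrier H ∩ carrier (g • H)).Nonempty) : (S ∩ g • S).Nonempty := by
  have hH' := hH.smul hπ.isometric g
  have hS' := hS.smul hπ.isometric g
  by_cases hg : g • H = H
  · obtain ⟨x, rfl⟩ := id hS
    rw [hπ.smul_halfspace_eq Φ hH hn hS hg, Set.inter_self]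
    exact ⟨x, Relation.ReflTransGen.refl⟩
  obtain ⟨x, hx, hx'⟩ := hc
  by_cases hxS : x ∈ S
  · exact hπ.median.inter_nonempty_of_mem_carrier hH hH' (Ne.symm hg) hS hS' hxS hx'
  by_cases hxS' : x ∈ g • S
  · rw [Set.inter_comm]
    exact hπ.median.inter_nonempty_of_mem_carrier hH' hH hg hS' hS hxS' hx
  obtain ⟨y, hy⟩ := hx
  obtain ⟨z, hz⟩ := hx'
  have hl := hπ.label_smul_eq Φ (g := g) hH hn (hπ.median.isHalfspace_compl hH hS) hy hz hxS
    (by rwa [Set.smul_set_compl])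
  have hyz : π y = π z := eq_of_label_eq Φ hπ.range.free _ _ hl
  exact absurd (hπ.eq_of_map_eq hH hn hH' hy hz rfl hyz).symm hg

/-- Transporting an edge of `H` in the carrier of the collapsed hyperplane `K` onto the edge of
`g • H` with the same label: strong collapsibility forces the transport to stabilize `K`. -/
theorem exists_smul_eq_of_transverse (hH : IsHyperplane Z H) (hn : H ∉ 𝓗) (hK : K ∈ 𝓗)
    (h : Transverse Z H K) (hc : (carrier (g • H) ∩ carrier K).Nonempty) :
    ∃ r : G, r • H = g • H ∧ r • K = K := by
  have hH' := hH.smul hπ.isometric g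
  have hn' := hπ.smul_notMem hn g
  have hK' := hπ.hyperplane K hK
  obtain ⟨x, ⟨y, hxy⟩, hx⟩ := hc
  obtain ⟨a, b, hab, ha, hl⟩ : ∃ (a b : V) (hab : (a, b) ∈ H), a ∈ carrier K ∧
      label Φ (hπ.adj hH hn hab) = label Φ (hπ.adj hH' hn' hxy) := by
    obtain ⟨a, b, c, d, hop, hab, hac⟩ := h
    rcases label_eq_or_eq_symm Φ _ _ (hπ.label_smul_fst_eq Φ g hH hn hab hxy) with hl | hl
    · exact ⟨a, b, hab, ⟨c, hac⟩, hl⟩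
    · refine ⟨b, a, hH.swap_mem hab, ⟨d, hK'.mem_of_opposite hac hop.transpose⟩, ?_⟩
      exact hl
  obtain ⟨r, hra, hrb⟩ := (label_eq_iff Φ _ _).1 hl
  rw [← hπ.map_smul] at hra hrb
  have hra' : r • a ∈ carrier (r • K) := by
    obtain ⟨c, hac⟩ := ha
    exact ⟨r • c, Set.smul_mem_smul_set hac⟩
  exact ⟨r, hπ.eq_of_map_eq (hH.smul hπ.isometric r) (hπ.smul_notMem hn r) hH'
    (Set.smul_mem_smul_set hab) hxy hra hrb, hπ.smul_eq_of_mem_carrier hK hx hra' hra.symm⟩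

theorem transverse_smul (hH : IsHyperplane Z H) (hn : H ∉ 𝓗) (hK : IsHyperplane Z K)
    (h : Transverse Z H K) (hc : (carrier (g • H) ∩ carrier K).Nonempty) :
    Transverse Z (g • H) K := by
  by_cases hm : K ∈ 𝓗
  · obtain ⟨r, hrH, hrK⟩ := hπ.exists_smul_eq_of_transverse Φ hH hn hm h hc
    simpa only [hrH, hrK] using h.smul hπ.isometric r
  · have hH' := hH.smul hπ.isometric g
    have hn' := hπ.smul_notMem hn g
    obtain ⟨x, ⟨y, hy⟩, z, hz⟩ := hc
    obtain ⟨a, b, hab⟩ := hH.nonempty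
    have hadj := hπ.adj_label_of_transverse Φ hH hn hK hm h hab hz
    rw [hπ.label_smul_fst_eq Φ g hH hn hab hy] at hadj
    obtain ⟨w, hw⟩ := exists_opposite_of_adj_label Φ hπ.range.median hπ.range.isometric
      hπ.range.free _ _ hadj
    exact hπ.transverse hH' hn' hK hm hy hz hw

end IsStrongCollapse

theorem isCospecial_of_forall_exists_isStrongCollapse {V : Type u} {Z : SimpleGraph V} {G : Type v}
    [Group G] [MulAction G V] (hZ : IsFreeCAT0Action G Z)
    (h : ∀ H, IsHyperplane Z H → ∃ (V' : Type u) (Z' : SimpleGraph V') (_ : MulAction G V')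
      (𝓗 : Set (Set (V × V))) (π : V → V') (W : Type v) (Γ : SimpleGraph W),
        IsStrongCollapse G Z Z' 𝓗 π ∧ H ∉ 𝓗 ∧
          Nonempty (CubicalSet.Iso (quotient G Z') (salvetti Γ))) :
    IsCospecial G Z where
  toIsFreeCAT0Action := hZ
  two_sided g H hH hg S hS := by
    obtain ⟨V', Z', _, 𝓗, π, W, Γ, hπ, hn, ⟨Φ⟩⟩ := h H hH
    exact hπ.smul_halfspace_eq Φ hH hn hS hg
  no_self_intersection g H hH := by
    obtain ⟨V', Z', _, 𝓗, π, W, Γ, hπ, hn, ⟨Φ⟩⟩ := h H hH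
    exact hπ.not_transverse_smul Φ hH hn
  no_direct_self_osculation g H hH hc S hS := by
    obtain ⟨V', Z', _, 𝓗, π, W, Γ, hπ, hn, ⟨Φ⟩⟩ := h H hH
    exact hπ.inter_smul_nonempty Φ hH hn hS hc
  no_inter_osculation g H K hH hK ht hc := by
    obtain ⟨V', Z', _, 𝓗, π, W, Γ, hπ, hn, ⟨Φ⟩⟩ := h H hH
    exact hπ.transverse_smul Φ hH hn hK ht hc

theorem IsCospatial.exists_isStrongCollapse {W : Type v} {Γ : SimpleGraph W} {V : Type u}
    {Z : SimpleGraph V} [MulAction (RAAG Γ) V] (h : IsCospatial Γ Z) {H : Set (V × V)}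
    (hH : IsHyperplane Z H) :
    ∃ (V' : Type u) (Z' : SimpleGraph V') (_ : MulAction (RAAG Γ) V') (𝓗 : Set (Set (V × V)))
      (π : V → V'), IsStrongCollapse (RAAG Γ) Z Z' 𝓗 π ∧ H ∉ 𝓗 ∧ IsSalvettiLike Γ Z' := by
  obtain ⟨𝓗, h𝓗, hn, hs⟩ := h.exists_collapse H hH
  let action := collapseAction h.isometric h𝓗.toIsInvariantFamily
  exact ⟨_, _, action, 𝓗, _,
    isStrongCollapse_collapseMap h.median h.isometric h𝓗 hs.toIsFreeCAT0Action, hn, hs⟩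

theorem IsCospatial.isCospecial {W : Type v} {Γ : SimpleGraph W} {V : Type u}
    {Z : SimpleGraph V} [MulAction (RAAG Γ) V] (h : IsCospatial Γ Z) :
    IsCospecial (RAAG Γ) Z :=
  isCospecial_of_forall_exists_isStrongCollapse h.toIsFreeCAT0Action fun _ hH =>
    let ⟨V', Z', i, 𝓗, π, hπ, hn, hs⟩ := h.exists_isStrongCollapse hH
    ⟨V', Z', i, 𝓗, π, W, Γ, hπ, hn, hs.iso⟩

/-! ## Products of median graphs and the square grid -/

section Product

variable {α β : Type*} {X : SimpleGraph α} {Y : SimpleGraph β}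

theorem dist_boxProd (hX : X.Connected) (hY : Y.Connected) (p q : α × β) :
    (X.boxProd Y).dist p q = X.dist p.1 q.1 + Y.dist p.2 q.2 := by
  rw [SimpleGraph.dist, SimpleGraph.edist_boxProd, ENat.toNat_add]
  · rfl
  · exact SimpleGraph.edist_ne_top_iff_reachable.2 (hX _ _)
  · exact SimpleGraph.edist_ne_top_iff_reachable.2 (hY _ _)

theorem IsMedian.boxProd (hX : IsMedian X) (hY : IsMedian Y) : IsMedian (X.boxProd Y) := by
  refine ⟨hX.1.boxProd hY.1, fun p q r => ?_⟩
  simp only [dist_boxProd hX.1 hY.1]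
  obtain ⟨m, ⟨hm₁, hm₂, hm₃⟩, hm⟩ := hX.2 p.1 q.1 r.1
  obtain ⟨n, ⟨hn₁, hn₂, hn₃⟩, hn⟩ := hY.2 p.2 q.2 r.2
  refine ⟨(m, n), ⟨by simp only; omega, by simp only; omega, by simp only; omega⟩, ?_⟩
  rintro ⟨m', n'⟩ ⟨h₁, h₂, h₃⟩
  have hpq := hX.1.dist_triangle (u := p.1) (v := m') (w := q.1)
  have hqr := hX.1.dist_triangle (u := q.1) (v := m') (w := r.1)
  have hpr := hX.1.dist_triangle (u := p.1) (v := m') (w := r.1)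
  have hpq' := hY.1.dist_triangle (u := p.2) (v := n') (w := q.2)
  have hqr' := hY.1.dist_triangle (u := q.2) (v := n') (w := r.2)
  have hpr' := hY.1.dist_triangle (u := p.2) (v := n') (w := r.2)
  simp only at h₁ h₂ h₃
  exact Prod.ext (hm m' ⟨by omega, by omega, by omega⟩) (hn n' ⟨by omega, by omega, by omega⟩)

end Product

theorem hasse_int_adj {a b : ℤ} : (SimpleGraph.hasse ℤ).Adj a b ↔ (a - b).natAbs = 1 := by
  rw [SimpleGraph.hasse_adj, Order.covBy_iff_add_one_eq, Order.covBy_iff_add_one_eq]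
  omega

theorem hasse_int_connected : (SimpleGraph.hasse ℤ).Connected :=
  ⟨SimpleGraph.hasse_preconnected_of_succ ℤ⟩

theorem hasse_int_dist (a b : ℤ) : (SimpleGraph.hasse ℤ).dist a b = (a - b).natAbs := by
  refine le_antisymm ?_ ?_
  · wlog h : a ≤ b generalizing a b
    · have := this b a (by omega)
      rw [SimpleGraph.dist_comm]
      omega
    induction b, h using Int.leInduction with
    | base => simp
    | succ b _ ih =>
      have hb : (SimpleGraph.hasse ℤ).dist b (b + 1) = 1 :=
        SimpleGraph.dist_eq_one_iff_adj.2 (hasse_int_adj.2 (by omega))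
      have htri := hasse_int_connected.dist_triangle (u := a) (v := b) (w := b + 1)
      omega
  · obtain ⟨w, hw⟩ := hasse_int_connected.exists_walk_length_eq_dist a b
    rw [← hw]
    clear hw
    induction w with
    | nil => simp
    | cons h w ih =>
      rw [hasse_int_adj] at h
      rw [SimpleGraph.Walk.length_cons]
      omega

theorem isMedian_hasse_int : IsMedian (SimpleGraph.hasse ℤ) := by
  refine ⟨hasse_int_connected, fun a b c => ?_⟩
  simp only [hasse_int_dist]
  exact ⟨max (min a b) (min (max a b) c), ⟨by omega, by omega, by omega⟩, fun m h => by omega⟩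

theorem isMedian_squareGrid : IsMedian squareGrid := isMedian_hasse_int.boxProd isMedian_hasse_int

theorem squareGrid_dist (p q : ℤ × ℤ) :
    squareGrid.dist p q = (p.1 - q.1).natAbs + (p.2 - q.2).natAbs := by
  rw [dist_boxProd hasse_int_connected hasse_int_connected, hasse_int_dist, hasse_int_dist]

theorem squareGrid_adj {p q : ℤ × ℤ} :
    squareGrid.Adj p q ↔ (p.1 - q.1).natAbs + (p.2 - q.2).natAbs = 1 := by
  rw [← SimpleGraph.dist_eq_one_iff_adj, squareGrid_dist]

/-! ## Halfspaces of the square grid -/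

/-- The two coordinates of a point of the plane. -/
def coord : Bool → ℤ × ℤ →+ ℤ
  | false => AddMonoidHom.fst ℤ ℤ
  | true => AddMonoidHom.snd ℤ ℤ

/-- The left (for `k = false`) and lower (for `k = true`) halfspaces of the square grid. -/
def halfplane (k : Bool) (i : ℤ) : Set (ℤ × ℤ) := {p | coord k p ≤ i}

theorem exists_coord_eq (k : Bool) (i j : ℤ) : ∃ p, coord k p = i ∧ coord (!k) p = j := by
  cases k
  · exact ⟨(i, j), rfl, rfl⟩
  · exact ⟨(j, i), rfl, rfl⟩

theorem halfplane_inter_nonempty (k : Bool) (i j : ℤ) :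
    (halfplane k i ∩ halfplane k j).Nonempty := by
  obtain ⟨p, hp, -⟩ := exists_coord_eq k (min i j) 0
  exact ⟨p, hp.le.trans (min_le_left i j), hp.le.trans (min_le_right i j)⟩

theorem compl_halfplane_inter_nonempty (k : Bool) (i j : ℤ) :
    ((halfplane k i)ᶜ ∩ (halfplane k j)ᶜ).Nonempty := by
  obtain ⟨p, hp, -⟩ := exists_coord_eq k (max i j + 1) 0
  simp only [halfplane, Set.Nonempty, Set.mem_inter_iff, Set.mem_compl_iff, Set.mem_ofPred_eq]
  exact ⟨p, by omega, by omega⟩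

section Halfplanes

variable {H K : Set ((ℤ × ℤ) × (ℤ × ℤ))} {S : Set (ℤ × ℤ)} {k l : Bool} {i j : ℤ}

theorem exists_isHalfspace_halfplane (hH : IsHyperplane squareGrid H) :
    ∃ k i, IsHalfspace squareGrid H (halfplane k i) := by
  have of_mem {a b k i} (h : (a, b) ∈ H) (hki : ∀ x, coord k x ≤ i ↔
      (x.1 - a.1).natAbs + (x.2 - a.2).natAbs < (x.1 - b.1).natAbs + (x.2 - b.2).natAbs) :
      IsHalfspace squareGrid H (halfplane k i) := by
    rw [hH.eq_dualHyperplane h]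
    convert isMedian_squareGrid.isHalfspace_nearer (hH.adj h) using 1
    exact Set.ext fun x => by
      simpa only [nearer, squareGrid_dist, halfplane, Set.mem_ofPred_eq] using hki x
  obtain ⟨a, b, hab⟩ := hH.nonempty
  have hba := hH.swap_mem hab
  have hadj := squareGrid_adj.1 (hH.adj hab)
  obtain ⟨h₁, h₂⟩ | ⟨h₁, h₂⟩ | ⟨h₁, h₂⟩ | ⟨h₁, h₂⟩ :
      (a.1 + 1 = b.1 ∧ a.2 = b.2) ∨ (b.1 + 1 = a.1 ∧ a.2 = b.2) ∨
      (a.1 = b.1 ∧ a.2 + 1 = b.2) ∨ (a.1 = b.1 ∧ b.2 + 1 = a.2) := by omega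
  · exact ⟨false, a.1, of_mem hab fun x => by change x.1 ≤ a.1 ↔ _; omega⟩
  · exact ⟨false, b.1, of_mem hba fun x => by change x.1 ≤ b.1 ↔ _; omega⟩
  · exact ⟨true, a.2, of_mem hab fun x => by change x.2 ≤ a.2 ↔ _; omega⟩
  · exact ⟨true, b.2, of_mem hba fun x => by change x.2 ≤ b.2 ↔ _; omega⟩

theorem transverse_squareGrid_iff (hH : IsHyperplane squareGrid H) (hK : IsHyperplane squareGrid K)
    (hS : IsHalfspace squareGrid H (halfplane k i))
    (hT : IsHalfspace squareGrid K (halfplane l j)) : Transverse squareGrid H K ↔ k ≠ l := by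
  have hZ := isMedian_squareGrid
  constructor
  · rintro h rfl
    obtain ⟨p, hp, hp'⟩ := h.inter_nonempty hZ hH hK hS (hZ.isHalfspace_compl hK hT)
    obtain ⟨q, hq, hq'⟩ := h.inter_nonempty hZ hH hK (hZ.isHalfspace_compl hH hS) hT
    simp only [halfplane, Set.mem_compl_iff, Set.mem_ofPred_eq] at hp hp' hq hq'
    omega
  · intro hkl
    obtain rfl : l = !k := Bool.eq_not_of_ne hkl.symm
    have point (i' j') : ∃ p, coord k p = i' ∧ coord (!k) p = j' := exists_coord_eq k i' j'
    obtain ⟨p₁, h₁, h₁'⟩ := point i j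
    obtain ⟨p₂, h₂, h₂'⟩ := point i (j + 1)
    obtain ⟨p₃, h₃, h₃'⟩ := point (i + 1) j
    obtain ⟨p₄, h₄, h₄'⟩ := point (i + 1) (j + 1)
    refine hZ.transverse_of_inter_nonempty hH hK hS hT ⟨p₁, ?_⟩ ⟨p₂, ?_⟩ ⟨p₃, ?_⟩ ⟨p₄, ?_⟩ <;>
      simp only [halfplane, Set.mem_inter_iff, Set.mem_compl_iff, Set.mem_ofPred_eq] <;> omega

end Halfplanes

/-! ## Actions by translations -/

theorem isFree_of_translations {A G : Type*} [AddCommGroup A] [IsAddTorsionFree A] [Group G]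
    [MulAction G A] {τ : G → A} (hτ : ∀ (g : G) (a : A), g • a = a + τ g)
    (hinj : ∀ g, τ g = 0 → g = 1) (Z : SimpleGraph A) : IsFree G Z := by
  classical
  intro g n c _ h
  let F : Finset A := Finset.univ.image c
  have hF : F.image (· + τ g) = F := by
    rw [← Finset.coe_inj]
    simpa only [F, Finset.coe_image, Finset.coe_univ, Set.image_univ, ← Set.image_smul, hτ] using h
  -- The translation by `τ g` permutes the finite set `F`, hence preserves the sum of its elements.
  have hsum : ∑ a ∈ F, a = ∑ a ∈ F, a + F.card • τ g := by
    conv_lhs => rw [← hF, Finset.sum_image (add_left_injective _).injOn]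
    rw [Finset.sum_add_distrib, Finset.sum_const]
  have hcard : F.card ≠ 0 := (Finset.univ_nonempty.image c).card_ne_zero
  exact hinj g ((nsmul_eq_zero_iff.1 (left_eq_add.1 hsum)).resolve_right hcard)

section Translations

variable {G : Type*} [Group G] [MulAction G (ℤ × ℤ)] {τ : G → ℤ × ℤ}
  (hτ : ∀ (g : G) (p : ℤ × ℤ), g • p = p + τ g)

include hτ

theorem isIsometric_squareGrid : IsIsometric G squareGrid := by
  intro g x y
  simp only [squareGrid_adj, hτ, Prod.fst_add, Prod.snd_add, add_sub_add_right_eq_sub]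

theorem smul_halfplane (g : G) (k : Bool) (i : ℤ) :
    g • halfplane k i = halfplane k (i + coord k (τ g)) := by
  ext p
  have : g⁻¹ • p = p - τ g := by rw [inv_smul_eq_iff, hτ, sub_add_cancel]
  simp only [Set.mem_smul_set_iff_inv_smul_mem, this, halfplane, Set.mem_ofPred_eq, map_sub,
    sub_le_iff_le_add]

theorem inter_smul_nonempty_squareGrid {H : Set ((ℤ × ℤ) × (ℤ × ℤ))} {S : Set (ℤ × ℤ)}
    (hH : IsHyperplane squareGrid H) (hS : IsHalfspace squareGrid H S) (g : G) :
    (S ∩ g • S).Nonempty := by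
  obtain ⟨k, i, hi⟩ := exists_isHalfspace_halfplane hH
  rcases isMedian_squareGrid.eq_or_eq_compl hH hi hS with rfl | rfl
  · rw [smul_halfplane hτ]
    exact halfplane_inter_nonempty _ _ _
  · rw [Set.smul_set_compl, smul_halfplane hτ]
    exact compl_halfplane_inter_nonempty _ _ _

theorem exists_isHalfspace_halfplane_smul {H : Set ((ℤ × ℤ) × (ℤ × ℤ))}
    (hH : IsHyperplane squareGrid H) (g : G) :
    ∃ k i j, IsHalfspace squareGrid H (halfplane k i) ∧
      IsHalfspace squareGrid (g • H) (halfplane k j) := by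
  obtain ⟨k, i, hi⟩ := exists_isHalfspace_halfplane hH
  exact ⟨k, i, _, hi, smul_halfplane hτ g k i ▸ hi.smul (isIsometric_squareGrid hτ) g⟩

theorem isCospecial_squareGrid (hinj : ∀ g, τ g = 0 → g = 1) : IsCospecial G squareGrid where
  median := isMedian_squareGrid
  isometric := isIsometric_squareGrid hτ
  free := isFree_of_translations hτ hinj squareGrid
  two_sided g _ hH hg _ hS := isMedian_squareGrid.smul_eq_of_inter_nonempty
    (isIsometric_squareGrid hτ) hH hS hg (inter_smul_nonempty_squareGrid hτ hH hS g)
  no_self_intersection g H hH := by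
    obtain ⟨k, i, j, hi, hj⟩ := exists_isHalfspace_halfplane_smul hτ hH g
    simp [transverse_squareGrid_iff hH (hH.smul (isIsometric_squareGrid hτ) g) hi hj]
  no_direct_self_osculation g _ hH _ _ hS := inter_smul_nonempty_squareGrid hτ hH hS g
  no_inter_osculation g H K hH hK h _ := by
    obtain ⟨k, i, j, hi, hj⟩ := exists_isHalfspace_halfplane_smul hτ hH g
    obtain ⟨l, m, hm⟩ := exists_isHalfspace_halfplane hK
    rw [transverse_squareGrid_iff hH hK hi hm] at h
    exact (transverse_squareGrid_iff (hH.smul (isIsometric_squareGrid hτ) g) hK hj hm).2 h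

end Translations

/-! ## Cocompactness -/

section Cocompact

variable {V G : Type*} [Group G] [MulAction G V] {Z : SimpleGraph V} {F : Set V}

theorem IsIsometric.dist_smul_le (hG : IsIsometric G Z) (hZ : Z.Connected) (g : G) (x y : V) :
    Z.dist (g • x) (g • y) ≤ Z.dist x y := by
  let φ : Z →g Z := ⟨(g • ·), (hG g _ _).2⟩
  obtain ⟨w, hw⟩ := hZ.exists_walk_length_eq_dist x y
  exact (SimpleGraph.dist_le (w.map φ)).trans_eq ((w.length_map φ).trans hw)

theorem IsIsometric.dist_smul (hG : IsIsometric G Z) (hZ : Z.Connected) (g : G) (x y : V) :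
    Z.dist (g • x) (g • y) = Z.dist x y :=
  (hG.dist_smul_le hZ g x y).antisymm <| by
    simpa only [inv_smul_smul] using hG.dist_smul_le hZ g⁻¹ (g • x) (g • y)

theorem IsCube.smul {n : ℕ} {c : (Fin n → Bool) → V} (hc : IsCube Z c) (hG : IsIsometric G Z)
    (hZ : Z.Connected) (g : G) : IsCube Z fun x => g • c x := fun x y => by
  rw [hG.dist_smul hZ, hc]

theorem IsCube.dist_origin_le {n : ℕ} {c : (Fin n → Bool) → V} (hc : IsCube Z c)
    (x : Fin n → Bool) : Z.dist (c fun _ => false) (c x) ≤ n := by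
  simpa only [hc _ _, Fintype.card_fin] using
    hammingDist_le_card_fintype (x := fun _ : Fin n => false) (y := x)

theorem IsCube.dim_le_ncard {n : ℕ} {c : (Fin n → Bool) → V} (hc : IsCube Z c)
    {B : Set V} (hB : B.Finite) (hcB : ∀ x, Z.dist (c fun _ => false) (c x) ≤ 1 → c x ∈ B) :
    n ≤ B.ncard := by
  let e (i : Fin n) : Fin n → Bool := Pi.single i true
  have he (i) : hammingDist (fun _ => false) (e i) = 1 := by
    simp [e, hammingDist, Pi.single_apply, Finset.filter_eq']
  have hinj : Function.Injective (c ∘ e) := fun i j hij => by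
    have hd : hammingDist (e i) (e j) = 0 := by
      rw [← hc, Function.comp_apply.symm.trans hij, Function.comp_apply, SimpleGraph.dist_self]
    have := congrFun (hammingDist_eq_zero.1 hd) i
    simpa [e, Pi.single_apply] using this
  calc n = (Set.range (c ∘ e)).ncard := by rw [Set.ncard_range_of_injective hinj, Nat.card_fin]
    _ ≤ B.ncard := Set.ncard_le_ncard
      (Set.range_subset_iff.2 fun i => hcB _ ((hc _ _).trans (he i)).le) hB

theorem exists_cell_eq_of_mem (hG : IsIsometric G Z) (hZ : Z.Connected)
    (hF : ∀ x, ∃ g : G, g • x ∈ F) {n : ℕ} (q : (quotient G Z).Cell n) :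
    ∃ (c : (Fin n → Bool) → V) (hc : IsCube Z c), (c fun _ => false) ∈ F ∧ cell G hc = q := by
  obtain ⟨c, hc, rfl⟩ := exists_cell_eq q
  obtain ⟨g, hg⟩ := hF (c fun _ => false)
  exact ⟨_, hc.smul hG hZ g, hg, (cell_eq_iff _ _).2 ⟨g⁻¹, fun x => inv_smul_smul g (c x)⟩⟩

theorem isCompact_quotient (hG : IsIsometric G Z) (hZ : Z.Connected)
    (hfin : ∀ r, {y | ∃ x ∈ F, Z.dist x y ≤ r}.Finite) (hF : ∀ x, ∃ g : G, g • x ∈ F) :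
    (quotient G Z).IsCompact := by
  let B (r : ℕ) : Set V := {y | ∃ x ∈ F, Z.dist x y ≤ r}
  have hB (r) : Finite (B r) := hfin r
  let T := Σ n : Fin ((B 1).ncard + 1), {c : (Fin n → Bool) → B n // IsCube Z fun x => (c x : V)}
  refine Finite.of_surjective (fun t : T => (⟨t.1, cell G t.2.2⟩ : Σ n, (quotient G Z).Cell n)) ?_
  rintro ⟨n, q⟩
  obtain ⟨c, hc, hcF, rfl⟩ := exists_cell_eq_of_mem hG hZ hF q
  have hn : n ≤ (B 1).ncard := hc.dim_le_ncard (hfin 1) fun x hx => ⟨_, hcF, hx⟩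
  exact ⟨⟨⟨n, Nat.lt_succ_of_le hn⟩, fun x => ⟨c x, _, hcF, hc.dist_origin_le x⟩, hc⟩, rfl⟩

theorem cocompact_squareGrid {G : Type*} [Group G] [MulAction G (ℤ × ℤ)] {τ : G → ℤ × ℤ}
    (hτ : ∀ (g : G) (p : ℤ × ℤ), g • p = p + τ g)
    (hsurj : ∀ v : ℤ × ℤ, Even (v.1 + v.2) → ∃ g, τ g = v) :
    (quotient G squareGrid).IsCompact := by
  refine isCompact_quotient (F := {(0, 0), (1, 0)}) (isIsometric_squareGrid hτ)
    isMedian_squareGrid.1 (fun r => ?_) fun p => ?_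
  · refine (Set.finite_Icc ((-r - 1, -r - 1) : ℤ × ℤ) (r + 1, r + 1)).subset ?_
    rintro y ⟨x, rfl | rfl, hxy⟩ <;>
      simp only [squareGrid_dist, Set.mem_Icc, Prod.le_def] at hxy ⊢ <;> omega
  · rcases Int.even_or_odd (p.1 + p.2) with h | h
    · obtain ⟨g, hg⟩ := hsurj (-p) (by rw [Prod.fst_neg, Prod.snd_neg, ← neg_add]; exact h.neg)
      exact ⟨g, Or.inl (by rw [hτ, hg, add_neg_cancel]; rfl)⟩
    · obtain ⟨g, hg⟩ := hsurj ((1, 0) - p) (by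
        simp only [Prod.fst_sub, Prod.snd_sub, Int.even_iff, Int.odd_iff] at h ⊢
        omega)
      exact ⟨g, Or.inr (by rw [hτ, hg, add_sub_cancel]; rfl)⟩

end Cocompact

/-! ## Spatial complexes and indirect self-osculation -/

/-- Every hyperplane of `X` indirectly self-osculates: each oriented edge `e` is a side of a square
whose opposite side, once reversed, is another edge with the same origin. -/
def CubicalSet.IsIndirectlySelfOsculating (X : CubicalSet.{u}) : Prop :=
  ∀ e : X.Cell 1, ∃ s : X.Cell 2, X.face (FaceMap.edge ![false, false] 0) s = e ∧
    X.reverse (X.face (FaceMap.edge ![false, true] 0) s) ≠ e ∧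
    X.origin (X.reverse (X.face (FaceMap.edge ![false, true] 0) s)) = X.origin e

theorem CubicalSet.IsIndirectlySelfOsculating.of_iso {X : CubicalSet.{u}} {Y : CubicalSet.{v}}
    (hX : X.IsIndirectlySelfOsculating) (Φ : CubicalSet.Iso X Y) :
    Y.IsIndirectlySelfOsculating := by
  intro e
  obtain ⟨e, rfl⟩ := (Φ.equiv 1).surjective e
  obtain ⟨s, rfl, hne, ho⟩ := hX e
  simp only [CubicalSet.origin, CubicalSet.reverse] at hne ho ⊢
  refine ⟨Φ.equiv 2 s, ?_, ?_, ?_⟩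
  · rw [← Φ.map_face]
  · rwa [← Φ.map_face, ← Φ.map_face, (Φ.equiv 1).injective.ne_iff]
  · rw [← Φ.map_face, ← Φ.map_face, ← Φ.map_face, ← Φ.map_face, ho]

section SelfOsculation

variable {V : Type u} {Z : SimpleGraph V} {G : Type v} [Group G] [MulAction G V]

theorem exists_smul_ne_of_isIndirectlySelfOsculating (hZ : IsMedian Z) (hG : IsIsometric G Z)
    (h : (quotient G Z).IsIndirectlySelfOsculating) {K : Set (V × V)} (hK : IsHyperplane Z K) :
    ∃ g : G, g • K ≠ K ∧ (carrier K ∩ carrier (g • K)).Nonempty := by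
  obtain ⟨a, b, hab⟩ := hK.nonempty
  obtain ⟨s, hs, hne, ho⟩ := h (edgeCell G (hK.adj hab))
  obtain ⟨c, d, hop, rfl⟩ := exists_squareCell_eq hZ hG _ s hs
  rw [face_squareCell_right, reverse_edgeCell] at hne ho
  rw [origin_edgeCell, origin_edgeCell, vertexCell_eq_iff] at ho
  obtain ⟨g, rfl⟩ := ho
  have hgdc : (g • d, g • c) ∈ g • K :=
    Set.smul_mem_smul_set (hK.swap_mem (hK.mem_of_opposite hab hop))
  refine ⟨g, fun hg => hne ((edgeCell_eq_iff _ _).2 ⟨g, rfl, ?_⟩), g • d, ⟨b, hab⟩, ⟨_, hgdc⟩⟩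
  exact hZ.eq_of_mem_of_mem hK (hg ▸ hgdc) hab

/-- All hyperplanes of the collapsed family would violate strong collapsibility, so that nothing is
collapsed. -/
theorem IsStrongCollapse.injective_of_isIndirectlySelfOsculating {V' : Type u} [MulAction G V']
    {Z' : SimpleGraph V'} {𝓗 : Set (Set (V × V))} {π : V → V'}
    (hπ : IsStrongCollapse G Z Z' 𝓗 π) (h : (quotient G Z).IsIndirectlySelfOsculating) :
    Function.Injective π := by
  have notMem (K) : K ∉ 𝓗 := fun hK => by
    obtain ⟨g, hg, x, hx, hx'⟩ := exists_smul_ne_of_isIndirectlySelfOsculating hπ.median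
      hπ.isometric h (hπ.hyperplane K hK)
    exact hg (hπ.smul_eq_of_mem_carrier hK hx hx' rfl)
  intro x y hxy
  by_contra hne
  obtain ⟨H, S, hH, hS, hx, hy⟩ := hπ.median.exists_separating hne
  exact hy ((hπ.mem_iff hH (notMem H) hS hxy).1 hx)

end SelfOsculation

theorem IsSpatial.subsingleton_of_isIndirectlySelfOsculating {X : CubicalSet.{u}}
    (hX : IsSpatial X) (h : X.IsIndirectlySelfOsculating) : Subsingleton (X.Cell 0) := by
  obtain ⟨W, -, -, Γ, V, Z, _, hZ, ⟨Φ⟩⟩ := hX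
  refine (Φ.equiv 0).subsingleton_congr.2 ⟨fun p q => ?_⟩
  obtain ⟨x, rfl⟩ := exists_vertexCell_eq p
  obtain ⟨y, rfl⟩ := exists_vertexCell_eq q
  obtain rfl | hxy := eq_or_ne x y
  · rfl
  obtain ⟨H, -, hH, -⟩ := hZ.median.exists_separating hxy
  obtain ⟨V', Z', _, 𝓗, π, hπ, -, hs⟩ := hZ.exists_isStrongCollapse hH
  obtain ⟨Ψ⟩ := hs.iso
  obtain ⟨g, hg⟩ := exists_smul_eq_of_iso Ψ (π x) (π y)
  exact vertexCell_eq_iff.2 ⟨g, hπ.injective_of_isIndirectlySelfOsculating (h.of_iso Φ)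
    ((hπ.map_smul g x).trans hg)⟩

theorem exists_opposite_squareGrid {u v : ℤ × ℤ} (h : squareGrid.Adj u v) : ∃ u' v',
    Opposite squareGrid (u, v) (u', v') ∧ v' - u' = v - u ∧ Even ((v' - u).1 + (v' - u).2) := by
  rw [squareGrid_adj] at h
  refine ⟨(u.1 - (v.2 - u.2), u.2 + (v.1 - u.1)), (v.1 - (v.2 - u.2), v.2 + (v.1 - u.1)),
    ⟨?_, ?_, ?_, ?_, ?_, ?_⟩, ?_, ?_⟩
  iterate 4 · simp only [squareGrid_adj]; omega
  iterate 2 · simp only [ne_eq, Prod.ext_iff]; omega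
  · ext <;> simp
  · simp only [Int.even_iff, Prod.fst_sub, Prod.snd_sub]
    omega

section NotSpatial

variable {G : Type v} [Group G] [MulAction G (ℤ × ℤ)] {τ : G → ℤ × ℤ}
  (hτ : ∀ (g : G) (p : ℤ × ℤ), g • p = p + τ g)
  (hsurj : ∀ v : ℤ × ℤ, Even (v.1 + v.2) → ∃ g, τ g = v)

include hτ hsurj

theorem isIndirectlySelfOsculating_quotient_squareGrid :
    (quotient G squareGrid).IsIndirectlySelfOsculating := by
  intro e
  obtain ⟨u, v, huv, rfl⟩ := exists_edgeCell_eq e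
  obtain ⟨u', v', hop, hsub, heven⟩ := exists_opposite_squareGrid huv
  refine ⟨squareCell G isMedian_squareGrid hop, face_squareCell_left _ _, ?_, ?_⟩ <;>
    rw [face_squareCell_right, reverse_edgeCell]
  · rw [ne_eq, edgeCell_eq_iff]
    rintro ⟨g, rfl, rfl⟩
    rw [squareGrid_adj] at huv
    simp only [hτ, Prod.ext_iff, Prod.fst_sub, Prod.snd_sub, Prod.fst_add, Prod.snd_add]
      at hsub huv
    omega
  · rw [origin_edgeCell, origin_edgeCell, vertexCell_eq_iff]
    obtain ⟨g, hg⟩ := hsurj (-(v' - u)) <| by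
      rw [Prod.fst_neg, Prod.snd_neg, ← neg_add]
      exact heven.neg
    exact ⟨g, by rw [hτ, hg, neg_sub, add_sub_cancel]⟩

end NotSpatial

theorem not_isSpatial_squareGrid {G : Type} [Group G] [MulAction G (ℤ × ℤ)] {τ : G → ℤ × ℤ}
    (hτ : ∀ (g : G) (p : ℤ × ℤ), g • p = p + τ g)
    (hsurj : ∀ v : ℤ × ℤ, Even (v.1 + v.2) → ∃ g, τ g = v)
    (heven : ∀ g, Even ((τ g).1 + (τ g).2)) : ¬ IsSpatial (quotient G squareGrid) := by
  intro h
  have := h.subsingleton_of_isIndirectlySelfOsculating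
    (isIndirectlySelfOsculating_quotient_squareGrid hτ hsurj)
  obtain ⟨g, hg⟩ := vertexCell_eq_iff.1 <| Subsingleton.elim
    (vertexCell G squareGrid (0, 0)) (vertexCell G squareGrid (1, 0))
  have hg' : τ g = (1, 0) := by rw [← hg, hτ, Prod.mk_zero_zero, zero_add]
  have := heven g
  rw [hg'] at this
  exact absurd this (by decide)

/-! ## The diagonal action of `ℤ²` on the grid -/

theorem commute_of_edgeGraph :
    Commute (PresentedGroup.of 0 : RAAG edgeGraph) (PresentedGroup.of 1) := by
  have : (PresentedGroup.of 0 * PresentedGroup.of 1 * (PresentedGroup.of 0)⁻¹ *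
      (PresentedGroup.of 1)⁻¹ : RAAG edgeGraph) = 1 :=
    PresentedGroup.one_of_mem ⟨0, 1, by simp, rfl⟩
  rwa [mul_inv_eq_one, mul_inv_eq_iff_eq_mul] at this

theorem exists_eq_zpow_mul_zpow (g : RAAG edgeGraph) :
    ∃ m n : ℤ, g = PresentedGroup.of 0 ^ m * PresentedGroup.of 1 ^ n := by
  have hc := commute_of_edgeGraph
  have hg : g ∈ Subgroup.closure (Set.range (PresentedGroup.of : Fin 2 → RAAG edgeGraph)) :=
    PresentedGroup.closure_range_of _ ▸ Subgroup.mem_top g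
  induction hg using Subgroup.closure_induction with
  | mem x hx =>
    obtain ⟨i, rfl⟩ := hx
    fin_cases i
    · exact ⟨1, 0, by simp⟩
    · exact ⟨0, 1, by simp⟩
  | one => exact ⟨0, 0, by simp⟩
  | mul x y _ _ hx hy =>
    obtain ⟨m, n, rfl⟩ := hx
    obtain ⟨m', n', rfl⟩ := hy
    refine ⟨m + m', n + n', ?_⟩
    rw [zpow_add, zpow_add, mul_assoc, ← mul_assoc (_ ^ n), ← (hc.zpow_zpow m' n).eq]
    simp only [mul_assoc]
  | inv x _ hx =>
    obtain ⟨m, n, rfl⟩ := hx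
    refine ⟨-m, -n, ?_⟩
    rw [mul_inv_rev, zpow_neg, zpow_neg, ((hc.zpow_zpow m n).inv_inv).eq]

/-- The translation vectors of the elements of `ℤ² = ⟨(1,1), (-1,1)⟩`. -/
def diagonalHom : RAAG edgeGraph →* Multiplicative (ℤ × ℤ) :=
  PresentedGroup.toGroup (f := fun i : Fin 2 => Multiplicative.ofAdd (![(1, 1), (-1, 1)] i)) (by
    rintro r ⟨a, b, -, rfl⟩
    simp)

theorem diagonalHom_of (i : Fin 2) :
    diagonalHom (PresentedGroup.of i) = Multiplicative.ofAdd (![((1 : ℤ), (1 : ℤ)), (-1, 1)] i) :=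
  PresentedGroup.toGroup.of _

theorem diagonalHom_zpow (m n : ℤ) : (diagonalHom (PresentedGroup.of 0 ^ m *
    PresentedGroup.of 1 ^ n)).toAdd = (m - n, m + n) := by
  rw [map_mul, map_zpow, map_zpow, diagonalHom_of, diagonalHom_of, toAdd_mul, toAdd_zpow,
    toAdd_zpow]
  ext <;> simp
  ring

theorem eq_one_of_diagonalHom_eq_zero (g : RAAG edgeGraph) (hg : (diagonalHom g).toAdd = 0) :
    g = 1 := by
  obtain ⟨m, n, rfl⟩ := exists_eq_zpow_mul_zpow g
  rw [diagonalHom_zpow, Prod.mk_eq_zero] at hg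
  obtain rfl : m = 0 := by omega
  obtain rfl : n = 0 := by omega
  rw [zpow_zero, zpow_zero, one_mul]

theorem exists_diagonalHom_eq (v : ℤ × ℤ) (hv : Even (v.1 + v.2)) :
    ∃ g, (diagonalHom g).toAdd = v := by
  obtain ⟨m, hm⟩ := hv
  refine ⟨PresentedGroup.of 0 ^ m * PresentedGroup.of 1 ^ (v.2 - m), ?_⟩
  rw [diagonalHom_zpow]
  ext <;> simp only <;> omega

theorem even_diagonalHom (g : RAAG edgeGraph) :
    Even ((diagonalHom g).toAdd.1 + (diagonalHom g).toAdd.2) := by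
  obtain ⟨m, n, rfl⟩ := exists_eq_zpow_mul_zpow g
  rw [diagonalHom_zpow]
  exact ⟨m, by ring⟩

/-- The action of `ℤ² = ⟨(1,1), (-1,1)⟩` on the plane. -/
abbrev diagonalAction : MulAction (RAAG edgeGraph) (ℤ × ℤ) where
  smul g p := p + (diagonalHom g).toAdd
  one_smul p := by
    change p + (diagonalHom 1).toAdd = p
    rw [map_one, toAdd_one, add_zero]
  mul_smul g h p := by
    change p + (diagonalHom (g * h)).toAdd = p + (diagonalHom h).toAdd + (diagonalHom g).toAdd
    rw [map_mul, toAdd_mul, add_assoc, add_comm (diagonalHom g).toAdd]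

/-- The identity isomorphism. -/
def CubicalSet.Iso.refl (X : CubicalSet.{u}) : CubicalSet.Iso X X where
  equiv _ := Equiv.refl _
  map_face _ _ := rfl

theorem IsCospatial.isSpatial {W : Type u} [hW : Finite W] [hW' : Nonempty W] {Γ : SimpleGraph W}
    {V : Type u} {Z : SimpleGraph V} [i : MulAction (RAAG Γ) V] (h : IsCospatial Γ Z) :
    IsSpatial (quotient (RAAG Γ) Z) :=
  ⟨W, hW, hW', Γ, V, Z, i, h, ⟨.refl _⟩⟩

theorem IsCospecial.isSpecial {G V : Type u} [i : Group G] [j : MulAction G V]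
    {Z : SimpleGraph V} (h : IsCospecial G Z) : IsSpecial (quotient G Z) :=
  ⟨G, i, V, Z, j, h, ⟨.refl _⟩⟩

theorem IsSpatial.isSpecial {X : CubicalSet.{u}} (h : IsSpatial X) : IsSpecial X := by
  obtain ⟨W, _, _, Γ, V, Z, _, hZ, hX⟩ := h
  exact ⟨RAAG Γ, _, V, Z, _, hZ.isCospecial, hX⟩

end CubeCx

open CubeCx

theorem lemma5p6 :
    -- Every cospatial action is cospecial.
    (∀ {W : Type v} [Finite W] [Nonempty W] (Γ : SimpleGraph W) {V : Type u} (Z : SimpleGraph V)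
      [MulAction (RAAG Γ) V], IsCospatial Γ Z → IsCospecial (RAAG Γ) Z) ∧
    -- Every spatial cube complex is special.
    (∀ X : CubicalSet.{u}, IsSpatial X → IsSpecial X) ∧
    -- The converse fails, for the action of `ℤ² = ⟨(1,1), (-1,1)⟩` on the plane and its quotient.
    (∃ _ : MulAction (RAAG edgeGraph) (ℤ × ℤ),
      (∀ p : ℤ × ℤ, (PresentedGroup.of 0 : RAAG edgeGraph) • p = p + (1, 1)) ∧
      (∀ p : ℤ × ℤ, (PresentedGroup.of 1 : RAAG edgeGraph) • p = p + (-1, 1)) ∧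
      IsGeometric (RAAG edgeGraph) squareGrid ∧
      IsCospecial (RAAG edgeGraph) squareGrid ∧
      ¬ IsCospatial edgeGraph squareGrid ∧
      IsSpecial (quotient (RAAG edgeGraph) squareGrid) ∧
      ¬ IsSpatial (quotient (RAAG edgeGraph) squareGrid)) := by
  refine ⟨fun _ _ _ _ h => h.isCospecial, fun _ h => h.isSpecial, diagonalAction, ?_⟩
  let := diagonalAction
  have hτ (g : RAAG edgeGraph) (p : ℤ × ℤ) : g • p = p + (diagonalHom g).toAdd := rfl
  have hcospecial := isCospecial_squareGrid hτ eq_one_of_diagonalHom_eq_zero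
  have hcompact := cocompact_squareGrid hτ exists_diagonalHom_eq
  have hspatial := not_isSpatial_squareGrid hτ exists_diagonalHom_eq even_diagonalHom
  exact ⟨fun p => by rw [hτ, diagonalHom_of]; rfl, fun p => by rw [hτ, diagonalHom_of]; rfl,
    ⟨hcospecial.toIsFreeCAT0Action, hcompact⟩, hcospecial, fun h => hspatial h.isSpatial,
    hcospecial.isSpecial, hspatial⟩
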